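/- Let $X$ be a complete Hausdorff locally convex space over $\mathbb T\in\{\mathbb R,\mathbb C\}$, let $\mathcal L(X)$ be the space of continuous linear operators in $X$ with the strong operator topology, and let $X^*$ be the dual of $X$ with the topology of uniform convergence on bounded sets. For $F:[0,\infty)\to\mathcal L(X)$ let $F^*(s)=(F(s))^*$, and let $F'(0)$ (similarly ${F^*}'(0)$) be the operator $x\mapsto\lim_{h\to0+}h^{-1}(F(h)-F(0))x$, defined for all $x$ for which this limit exists. The many-valued effective derivative $F'_{mef}(0)$ assigns to $f\in X$ the set of all $g\in X$ for which there is a family $(f_h)_{h\ge 0}$ in $X$ with $f_h\to f$ and $h^{-1}(F(h)-F(0))f_h\to g$ as $h\to0+$; its domain is the set of $f$ for which this set is nonempty. When each of these sets has at most one element, $F'_{ef}(0)$ denotes the resulting single-valued operator with the same domain. Let $\mathcal E_X$ be the set of $F$ with $F(0)=I$ such that for each $s\ge0$ the family $\{F(d/n)^m : n,m\in\mathbb N,\ d\ge0,\ md/n\le s\}$ is equicontinuous, and let $\mathcal F_X$ be the set of $F\in\mathcal E_X$ for which the domain of $F'_{mef}(0)$ is dense in $X$ (for such $F$ the effective derivative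 $F'_{ef}(0)$ exists). An $lC_0$-semigroup is a continuous $T:[0,\infty)\to\mathcal L(X)$ with $T\in\mathcal E_X$, $T(0)=I$ and $T(l+m)=T(l)T(m)$ for all $l,m\ge 0$; its generator is $T'(0)$, and the semigroup with generator $G$ is denoted $\exp(sG)$, $s\ge 0$. A set $M\subset X^*$ is *-dense if each $\phi\in X^*$ is the pointwise limit on $X$ of a sequence in $M$. An operator is closable if the closure of its graph is the graph of a linear operator, its closure. $\mathcal D(\cdot)$ denotes the domain, $[\cdot]$ the integer part, $w\text{-}\lim$ the limit in $\sigma(X,X^*)$. **Theorem.** Let $Z$ be a densely defined linear operator in $X$ and $t>0$. Then $Z$ is closable and its closure $\overline Z$ is the generator of an $lC_0$-semigroup if and only if there exists $F\in\mathcal F_X$ such that: (i) $\mathcal D(Z)\subset\mathcal D(F'_{ef}(0))$ and $F'_{ef}(0)g=Zg$ for $g\in\mathcal D(Z)$; (ii) $\mathcal D({F^*}'(0))$ is *-dense in $X^*$; (iii) there is a dense linear subspace $A\subseteq\mathcal D(Z)$ such that for all $f\in A$ and $s\ge0$ there is a sequence $(f_n^s)_{n\ge1}$ in $\mathcal D(\overline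 Z)$ (where $Z$ is closable by (i)) with (a) $w\text{-}\lim_{n\to\infty}\bigl(F(t/n)^{[ns/t]}f-f_n^s\bigr)=0$; (b) each subsequence of $(\overline Zf_n^s)_n$ has a weakly convergent sub-subsequence; (c) each subsequence of $(f_n^s)_n$ has a weakly convergent sub-subsequence. Furthermore, if $F\in\mathcal F_X$ satisfies (i)–(iii), then $\exp(t\overline Z)f=\lim_{n\to\infty}F(t/n)^nf$ for each $f\in X$. -/

import Mathlib

open Filter Topology
open scoped NNReal

namespace LocConv

section Derivatives

variable {𝕜 V : Type*} [RCLike 𝕜] [AddCommGroup V] [Module 𝕜 V] [TopologicalSpace V]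

/-- The difference quotient `h⁻¹ (F(h) - F(0)) x` of an operator-valued function `F` on `[0, ∞)`. -/
noncomputable def diffQuot (F : ℝ≥0 → V →L[𝕜] V) (h : ℝ≥0) (x : V) : V :=
  (((h : ℝ) : 𝕜)⁻¹) • (F h x - F 0 x)

theorem diffQuot_zero (F : ℝ≥0 → V →L[𝕜] V) (h : ℝ≥0) : diffQuot F h 0 = 0 := by
  simp [diffQuot]

theorem diffQuot_add (F : ℝ≥0 → V →L[𝕜] V) (h : ℝ≥0) (x y : V) :
    diffQuot F h (x + y) = diffQuot F h x + diffQuot F h y := by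
  simp only [diffQuot, map_add, ← smul_add]
  congr 1
  abel

theorem diffQuot_smul (F : ℝ≥0 → V →L[𝕜] V) (h : ℝ≥0) (c : 𝕜) (x : V) :
    diffQuot F h (c • x) = c • diffQuot F h x := by
  simp only [diffQuot, map_smul, ← smul_sub]
  rw [smul_comm]

variable [IsTopologicalAddGroup V] [ContinuousSMul 𝕜 V]

/-- All pairs `(x, y)` such that `h⁻¹ (F(h) x - F(0) x) → y` as `h → 0`, `h > 0`. -/
def derivGraph (F : ℝ≥0 → V →L[𝕜] V) : Submodule 𝕜 (V × V) where
  carrier := {p | Tendsto (fun h => diffQuot F h p.1) (𝓝[>] 0) (𝓝 p.2)}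
  zero_mem' := by simp [diffQuot_zero, tendsto_const_nhds]
  add_mem' := by
    intro p q hp hq
    simpa [diffQuot_add] using Tendsto.add hp hq
  smul_mem' := by
    intro c p hp
    simpa [diffQuot_smul] using Tendsto.const_smul hp c

/-- The strong derivative `F'(0)` of `F` at `0`, as an unbounded operator; its domain consists of all
`x` for which `lim_{h → 0} h⁻¹ (F(h) x - F(0) x)` exists. -/
noncomputable def strongDeriv (F : ℝ≥0 → V →L[𝕜] V) : V →ₗ.[𝕜] V :=
  (derivGraph F).toLinearPMap

/-- In a Hausdorff space the graph of `F'(0)` is what it should be. -/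
theorem strongDeriv_graph [T2Space V] (F : ℝ≥0 → V →L[𝕜] V) :
    (strongDeriv F).graph = derivGraph F := by
  refine Submodule.toLinearPMap_graph_eq _ ?_
  rintro ⟨x, y⟩ hxy hx
  obtain rfl : x = 0 := hx
  have h : Tendsto (fun h => diffQuot F h 0) (𝓝[>] 0) (𝓝 y) := hxy
  simp only [diffQuot_zero] at h
  exact tendsto_nhds_unique h tendsto_const_nhds

/-- The many-valued effective derivative of `F` at `0`: the set of all
`g = lim_{h → 0} h⁻¹ (F(h) - F(0)) u(h)` where `u(h) → f` as `h → 0`. -/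
def mefDeriv (F : ℝ≥0 → V →L[𝕜] V) (f : V) : Set V :=
  {g | ∃ u : ℝ≥0 → V, Tendsto u (𝓝[>] 0) (𝓝 f) ∧
    Tendsto (fun h => diffQuot F h (u h)) (𝓝[>] 0) (𝓝 g)}

/-- The many-valued effective derivative as a linear relation. -/
def mefGraph (F : ℝ≥0 → V →L[𝕜] V) : Submodule 𝕜 (V × V) where
  carrier := {p | p.2 ∈ mefDeriv F p.1}
  zero_mem' := ⟨fun _ => 0, tendsto_const_nhds, by simp [diffQuot_zero, tendsto_const_nhds]⟩
  add_mem' := by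
    rintro p q ⟨u, hu, hu'⟩ ⟨v, hv, hv'⟩
    exact ⟨fun h => u h + v h, hu.add hv, by simpa [diffQuot_add] using hu'.add hv'⟩
  smul_mem' := by
    rintro c p ⟨u, hu, hu'⟩
    exact ⟨fun h => c • u h, hu.const_smul c, by simpa [diffQuot_smul] using hu'.const_smul c⟩

/-- The effective derivative `F'_ef(0)`, as an unbounded operator. Its domain is the set of all `f`
with `mefDeriv F f` nonempty, and `F'_ef(0) f` is the element of `mefDeriv F f` whenever the
many-valued effective derivative is single-valued. -/
noncomputable def effDeriv (F : ℝ≥0 → V →L[𝕜] V) : V →ₗ.[𝕜] V :=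
  (mefGraph F).toLinearPMap

theorem mem_effDeriv_domain (F : ℝ≥0 → V →L[𝕜] V) (f : V) :
    f ∈ (effDeriv F).domain ↔ (mefDeriv F f).Nonempty := by
  rw [effDeriv, Submodule.toLinearPMap_domain]
  constructor
  · rintro ⟨p, hp, rfl⟩
    exact ⟨p.2, hp⟩
  · rintro ⟨g, hg⟩
    exact ⟨(f, g), hg, rfl⟩

theorem effDeriv_mem (F : ℝ≥0 → V →L[𝕜] V)
    (hF : ∀ f, (mefDeriv F f).Subsingleton) (f : (effDeriv F).domain) :
    effDeriv F f ∈ mefDeriv F (f : V) := by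
  refine Submodule.mem_graph_toLinearPMap (g := mefGraph F) ?_ f
  rintro ⟨x, y⟩ hxy hx
  obtain rfl : x = 0 := hx
  exact hF 0 hxy (mefGraph F).zero_mem

end Derivatives

section Spaces

variable {𝕜 E : Type*} [RCLike 𝕜] [AddCommGroup E] [Module 𝕜 E] [UniformSpace E]

/-- The family `{F(d/n)^m | m d / n ≤ s, n, m ∈ {1, 2, …}, d ≥ 0}`. -/
def powerFamily (F : ℝ≥0 → E →L[𝕜] E) (s : ℝ≥0) : Set (E →L[𝕜] E) :=
  {g | ∃ (n m : ℕ) (d : ℝ≥0), 1 ≤ n ∧ 1 ≤ m ∧ (m : ℝ≥0) * d / n ≤ s ∧ g = F (d / n) ^ m}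

/-- The class `𝓔_E`: `F(0) = I` and each family `powerFamily F s` is equicontinuous. -/
structure MemE (F : ℝ≥0 → E →L[𝕜] E) : Prop where
  map_zero : F 0 = 1
  equicontinuous (s : ℝ≥0) : Equicontinuous (fun g : powerFamily F s => ⇑(g : E →L[𝕜] E))

variable [IsUniformAddGroup E] [ContinuousSMul 𝕜 E]

/-- The class `𝓕_E`: members of `𝓔_E` whose effective derivative at `0` is densely defined. -/
structure MemF (F : ℝ≥0 → E →L[𝕜] E) : Prop extends MemE F where
  dense_domain : Dense ((effDeriv F).domain : Set E)

/-- Locally equicontinuous strongly continuous one-parameter semigroups (`lC₀`-semigroups). -/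
structure IsLCSemigroup (T : ℝ≥0 → E →L[𝕜] E) : Prop extends MemE T where
  map_add (l m : ℝ≥0) : T (l + m) = T l * T m
  continuous (x : E) : Continuous fun s => T s x

/-- `Z` is the generator of the `lC₀`-semigroup `T`, that is, `Z = T'(0)`. -/
def IsGeneratorOf (Z : E →ₗ.[𝕜] E) (T : ℝ≥0 → E →L[𝕜] E) : Prop :=
  IsLCSemigroup T ∧ Z = strongDeriv T

/-- The adjoint function `F*(s) = F(s)*` on the dual space. `StrongDual 𝕜 E` carries the
topology of uniform convergence on bounded subsets of `E`. -/
noncomputable def adjointFun (F : ℝ≥0 → E →L[𝕜] E) (s : ℝ≥0) :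
    StrongDual 𝕜 E →L[𝕜] StrongDual 𝕜 E :=
  (F s).precomp 𝕜

/-- Every functional is the pointwise limit of a sequence in `A` (for a complete space `E`, which is
its own completion). -/
def StarDense (A : Set (StrongDual 𝕜 E)) : Prop :=
  ∀ φ : StrongDual 𝕜 E, ∃ u : ℕ → StrongDual 𝕜 E, (∀ k, u k ∈ A) ∧
    ∀ x : E, Tendsto (fun k => u k x) atTop (𝓝 (φ x))

variable (𝕜) in
/-- Weak convergence `w-lim u_n = x`, that is, convergence in the topology `σ(E, E*)`. -/
def WeakLim (u : ℕ → E) (x : E) : Prop :=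
  ∀ φ : StrongDual 𝕜 E, Tendsto (fun n => φ (u n)) atTop (𝓝 (φ x))

variable (𝕜) in
/-- Each subsequence of `u` has a weakly convergent sub-subsequence. -/
def WeakSeqRelCompact (u : ℕ → E) : Prop :=
  ∀ ψ : ℕ → ℕ, StrictMono ψ → ∃ θ : ℕ → ℕ, StrictMono θ ∧
    ∃ x : E, WeakLim 𝕜 (fun k => u (ψ (θ k))) x

/-- The conditions on `F` relative to the operator `Z` and the number `t > 0`. -/
structure GenerationConditions (Z : E →ₗ.[𝕜] E) (t : ℝ≥0) (F : ℝ≥0 → E →L[𝕜] E) : Prop where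
  /-- `F'_ef(0)` extends `Z`. -/
  extends_op : Z ≤ effDeriv F
  /-- The domain of the strong derivative of `F*` at `0` is *-dense. -/
  starDense : StarDense ((strongDeriv (adjointFun F)).domain : Set (StrongDual 𝕜 E))
  approx : ∃ A : Submodule 𝕜 E, A ≤ Z.domain ∧ Dense (A : Set E) ∧
    ∀ f ∈ A, ∀ s : ℝ≥0, ∃ a : ℕ → Z.closure.domain,
      WeakLim 𝕜 (fun n : ℕ => (F (t / n) ^ ⌊n * s / t⌋₊) f - (a n : E)) 0 ∧
      WeakSeqRelCompact 𝕜 (fun n => Z.closure (a n)) ∧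
      WeakSeqRelCompact 𝕜 (fun n => (a n : E))

end Spaces

end LocConv

/-!
Write `S_h(s) = F(h)^⌊s/h⌋` for the step evolutions of `F` (the integer part of `s/h`), and let `Ḡ` be
the closure of the graph of the effective derivative of `F`.

*Single-valuedness and the product formula.* Telescoping `F(h)^m - 1` and using equicontinuity of the
powers, every `(x, y) ∈ Ḡ` satisfies `F(h)^m x = x + m h y + o(m h)`, up to an error that tends to `0`
with `h`, uniformly in `m` (`MemF.exists_pow_expansion`). Hence `(0, y) ∈ Ḡ` forces `y = 0`, so every
restriction `Z` of the effective derivative is closable, with closure inside `Ḡ`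
(`MemF.isClosable`, `MemF.closure_graph_le`). The same expansion and a continuous induction in time
show that the step evolutions converge to any given classical solution `u` of `u' = Ḡ u`
(`MemF.tendsto_step`). Applied to the orbits of `T` this is the product formula
`F(t/n)^n f → T(t) f` (`MemF.tendsto_pow_of_isGeneratorOf`).

*Sufficiency.* Here the solution has to be produced. For `f ∈ A`, condition (iii) and a diagonal
extraction over a countable dense set of times give a subsequence along which `S_{t/n}(s) f`
converges weakly, for all `s`, to a continuous `v` with values in the domain of the closure of `Z`
(`MemF.exists_weakLim_step`). For `ψ` in the domain of the derivative `ψ ↦ ψ'` of the adjoint, `ψ ∘ v`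
has right derivative `ψ' ∘ v`, and `ψ' x = ψ (Z x)` (`MemF.hasRightDeriv_dual_weakLim`,
`dual_eq_of_mem_closure`). A general `ψ` is a pointwise limit of such `ψ_k` by *-density; these are
uniformly bounded on bounded sets (`exists_bound_of_pointwise_bounded`), which bounds the integrands
`ψ_k' ∘ v` (`MemF.exists_bounded_forall_dual_le`). Dominated convergence and the Hahn-Banach theorem
then show that `v` is a mild solution: `∫₀ᵃ v` lies in the domain of the closure of `Z`, which maps it
to `v(a) - f` (`MemF.mem_graph_of_isWeakIntegral`). The averages `s ↦ ∫ₛ^(s+a) v` are therefore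
classical solutions, so the step evolutions converge strongly on a dense set, hence everywhere. The
limit is a semigroup (`MemF.exists_semigroup`), whose generator is the closure of `Z`
(`GenerationConditions.exists_isGeneratorOf`).

*Necessity.* Take `F = T`. Only the *-density of the domain of the derivative of the adjoint needs an
argument: the adjoint semigroup need not be strongly continuous, but the double averages
`n² ∫∫ φ(T(r + s) x) dr ds` over `[0, 1/n]²` belong to that domain and converge to `φ` pointwise
(`IsLCSemigroup.starDense`).
-/

namespace LocConv

/-! ### Convergence and boundedness in terms of continuous seminorms -/

section Seminorms

variable {𝕜 E : Type*} [RCLike 𝕜] [AddCommGroup E] [Module 𝕜 E] [TopologicalSpace E]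
  [PolynormableSpace 𝕜 E]

variable (𝕜) in
theorem tendsto_iff_seminorm {ι : Type*} {l : Filter ι} {u : ι → E} {x : E} :
    Tendsto u l (𝓝 x) ↔
      ∀ p : Seminorm 𝕜 E, Continuous p → ∀ ε > 0, ∀ᶠ i in l, p (u i - x) < ε := by
  rw [(PolynormableSpace.withSeminorms 𝕜 E).tendsto_nhds]
  exact ⟨fun h p hp => h ⟨p, hp⟩, fun h p => h p.1 p.2⟩

variable (𝕜) in
/-- In a Hausdorff space the continuous seminorms separate points. -/
theorem eq_zero_of_seminorm [T2Space E] {x : E}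
    (h : ∀ p : Seminorm 𝕜 E, Continuous p → p x = 0) : x = 0 := by
  by_contra hx
  obtain ⟨p, hp⟩ := (PolynormableSpace.withSeminorms 𝕜 E).separating_of_T1 x hx
  exact hp (h p.1 p.2)

omit [PolynormableSpace 𝕜 E] in
theorem exists_near_of_mem_closure [IsTopologicalAddGroup E] {s : Set (E × E)} {x y : E}
    (h : (x, y) ∈ closure s)
    {p : Seminorm 𝕜 E} (hp : Continuous p) {ε : ℝ} (hε : 0 < ε) :
    ∃ x' y', (x', y') ∈ s ∧ p (x' - x) < ε ∧ p (y' - y) < ε := by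
  have hU : {z : E × E | p (z.1 - x) < ε ∧ p (z.2 - y) < ε} ∈ 𝓝 (x, y) := by
    refine (IsOpen.and ?_ ?_).mem_nhds ?_
    · exact isOpen_lt (hp.comp (by fun_prop)) continuous_const
    · exact isOpen_lt (hp.comp (by fun_prop)) continuous_const
    · simpa using hε
  obtain ⟨⟨x', y'⟩, h1, h2⟩ := mem_closure_iff_nhds.1 h _ hU
  exact ⟨x', y', h2, h1⟩

omit [PolynormableSpace 𝕜 E] in
theorem exists_near_of_dense [IsTopologicalAddGroup E] {s : Set E} (h : Dense s) (x : E)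
    {p : Seminorm 𝕜 E} (hp : Continuous p) {ε : ℝ} (hε : 0 < ε) :
    ∃ x' ∈ s, p (x' - x) < ε := by
  have hU : {z : E | p (z - x) < ε} ∈ 𝓝 x := by
    refine IsOpen.mem_nhds ?_ (by simpa using hε)
    exact isOpen_lt (hp.comp (by fun_prop)) continuous_const
  obtain ⟨x', h1, h2⟩ := mem_closure_iff_nhds.1 (h x) _ hU
  exact ⟨x', h2, h1⟩

omit [TopologicalSpace E] [PolynormableSpace 𝕜 E] in
theorem seminorm_real_smul (p : Seminorm 𝕜 E) (h : ℝ≥0) (x : E) :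
    p (((h : ℝ) : 𝕜) • x) = h * p x := by
  rw [map_smul_eq_mul, RCLike.norm_ofReal, NNReal.abs_eq]

theorem isVonNBounded_iff_seminorm {s : Set E} :
    Bornology.IsVonNBounded 𝕜 s ↔
      ∀ p : Seminorm 𝕜 E, Continuous p → ∃ C, ∀ x ∈ s, p x ≤ C := by
  rw [(PolynormableSpace.withSeminorms 𝕜 E).isVonNBounded_iff_seminorm_bddAbove]
  simp only [bddAbove_def, Set.forall_mem_image, Subtype.forall]

end Seminorms

/-! ### Expansion of the powers along the effective derivative -/

section Powers

variable {𝕜 E : Type*} [RCLike 𝕜] [AddCommGroup E] [Module 𝕜 E] [UniformSpace E]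
  [IsUniformAddGroup E] [ContinuousSMul 𝕜 E] [PolynormableSpace 𝕜 E]

theorem MemE.exists_bound {F : ℝ≥0 → E →L[𝕜] E} (hF : MemE F) (s : ℝ≥0)
    {p : Seminorm 𝕜 E} (hp : Continuous p) :
    ∃ q : Seminorm 𝕜 E, Continuous q ∧
      ∀ (h : ℝ≥0) (m : ℕ), m * h ≤ s → ∀ x, p ((F h ^ m) x) ≤ q x := by
  have H := ((PolynormableSpace.withSeminorms 𝕜 E).equicontinuous_TFAE
    (fun g : powerFamily F s => ((g : E →L[𝕜] E) : E →ₗ[𝕜] E))).out 1 3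
  obtain ⟨q, hq, hq'⟩ := H.1 (hF.equicontinuous s) ⟨p, hp⟩
  refine ⟨q ⊔ p, hq.sup hp, fun h m hm x => ?_⟩
  rcases Nat.eq_zero_or_pos m with rfl | hm0
  · exact le_sup_right
  · have := hq' ⟨F h ^ m, 1, m, h, le_rfl, hm0, by simpa using hm, by simp⟩ x
    exact this.trans le_sup_left

omit [ContinuousSMul 𝕜 E] [PolynormableSpace 𝕜 E] in
theorem pow_apply_sub_eq_sum (B : E →L[𝕜] E) (m : ℕ) (x : E) :
    (B ^ m) x - x = ∑ j ∈ Finset.range m, (B ^ j) (B x - x) := by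
  induction m with
  | zero => simp
  | succ m ih =>
    rw [Finset.sum_range_succ, ← ih, map_sub, ← mul_apply_eq_comp, ← pow_succ]
    abel

omit [ContinuousSMul 𝕜 E] [PolynormableSpace 𝕜 E] in
/-- Telescoping: `F(h)^m x - x` is a Riemann sum of `F(h)^j` applied to the difference quotient. -/
theorem MemE.pow_sub_eq_sum_diffQuot {F : ℝ≥0 → E →L[𝕜] E} (hF : MemE F) {h : ℝ≥0} (hh : 0 < h)
    (m : ℕ) (x : E) :
    (F h ^ m) x - x = ∑ j ∈ Finset.range m, ((h : ℝ) : 𝕜) • (F h ^ j) (diffQuot F h x) := by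
  rw [pow_apply_sub_eq_sum]
  refine Finset.sum_congr rfl fun j _ => ?_
  have : ((h : ℝ) : 𝕜) ≠ 0 := by simpa using hh.ne'
  rw [diffQuot, hF.map_zero, map_smul, smul_smul, mul_inv_cancel₀ this, one_smul]
  rfl

omit [UniformSpace E] [IsUniformAddGroup E] [ContinuousSMul 𝕜 E] [PolynormableSpace 𝕜 E] in
theorem seminorm_sum_le (p : Seminorm 𝕜 E) (h : ℝ≥0) (m : ℕ) (z : ℕ → E) {C : ℝ}
    (hz : ∀ j < m, p (z j) ≤ C) :
    p (∑ j ∈ Finset.range m, ((h : ℝ) : 𝕜) • z j) ≤ m * h * C := by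
  refine (Finset.le_sum_of_subadditive p (map_zero p).le (map_add_le_add p) _ _).trans ?_
  calc _ ≤ ∑ j ∈ Finset.range m, (h : ℝ) * C := by
        refine Finset.sum_le_sum fun j hj => ?_
        rw [seminorm_real_smul]
        exact mul_le_mul_of_nonneg_left (hz j (Finset.mem_range.1 hj)) h.2
    _ = _ := by simp [mul_assoc]

theorem natCast_mul_le_of_le {h s : ℝ≥0} {j m : ℕ} (hj : j ≤ m) (hm : m * h ≤ s) : j * h ≤ s :=
  le_trans (by gcongr) hm

/-- Approximate solvability: elements of the closure of the effective derivative are approximated,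
for small `h`, by pairs `(u, h⁻¹ (F(h) - F(0)) u)`. -/
theorem eventually_exists_diffQuot_near {F : ℝ≥0 → E →L[𝕜] E} {x y : E}
    (hxy : (x, y) ∈ (mefGraph F).topologicalClosure) {p : Seminorm 𝕜 E} (hp : Continuous p)
    {ε : ℝ} (hε : 0 < ε) :
    ∀ᶠ h in 𝓝[>] (0 : ℝ≥0), ∃ u, p (u - x) < ε ∧ p (diffQuot F h u - y) < ε := by
  obtain ⟨x', y', ⟨u, hu, hu'⟩, hx, hy⟩ := exists_near_of_mem_closure hxy hp (half_pos hε)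
  filter_upwards [(tendsto_iff_seminorm 𝕜).1 hu p hp _ (half_pos hε),
    (tendsto_iff_seminorm 𝕜).1 hu' p hp _ (half_pos hε)] with h h1 h2
  refine ⟨u h, ?_, ?_⟩
  · calc p (u h - x) = p ((u h - x') + (x' - x)) := by congr 1; abel
      _ ≤ _ := map_add_le_add _ _ _
      _ < ε := by linarith
  · calc p (diffQuot F h (u h) - y) = p ((diffQuot F h (u h) - y') + (y' - y)) := by congr 1; abel
      _ ≤ _ := map_add_le_add _ _ _
      _ < ε := by linarith

theorem MemE.eventually_pow_sub_sum_le {F : ℝ≥0 → E →L[𝕜] E} (hF : MemE F) {x y : E}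
    (hxy : (x, y) ∈ (mefGraph F).topologicalClosure) (s : ℝ≥0)
    {p : Seminorm 𝕜 E} (hp : Continuous p) {ε : ℝ} (hε : 0 < ε) :
    ∀ᶠ h in 𝓝[>] (0 : ℝ≥0), ∀ m : ℕ, m * h ≤ s →
      p ((F h ^ m) x - x - ∑ j ∈ Finset.range m, ((h : ℝ) : 𝕜) • (F h ^ j) y) ≤ ε := by
  obtain ⟨q, hq, hb⟩ := hF.exists_bound s hp
  have hpq : ∀ x, p x ≤ q x := fun x => by simpa using hb 0 0 (by simp) x
  have hε' : 0 < ε / (2 + s) := by positivity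
  filter_upwards [eventually_exists_diffQuot_near hxy hq hε', self_mem_nhdsWithin] with h hu h0 m hm
  obtain ⟨u, hux, huy⟩ := hu
  have e1 : (F h ^ m) x - x - ∑ j ∈ Finset.range m, ((h : ℝ) : 𝕜) • (F h ^ j) y
      = (u - x) - (F h ^ m) (u - x)
        + ∑ j ∈ Finset.range m, ((h : ℝ) : 𝕜) • (F h ^ j) (diffQuot F h u - y) := by
    simp only [map_sub, smul_sub, Finset.sum_sub_distrib]
    rw [← hF.pow_sub_eq_sum_diffQuot h0]
    abel
  have hmh : (m : ℝ) * h ≤ s := by exact_mod_cast hm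
  rw [e1]
  calc _ ≤ p (u - x) + p ((F h ^ m) (u - x)) + m * h * (ε / (2 + s)) := by
        refine (map_add_le_add _ _ _).trans (add_le_add (map_sub_le_add _ _ _) ?_)
        refine seminorm_sum_le p h m _ fun j hj => ?_
        exact (hb h j (natCast_mul_le_of_le hj.le hm) _).trans huy.le
    _ ≤ ε / (2 + s) + ε / (2 + s) + s * (ε / (2 + s)) := by
        gcongr
        · exact (hpq _).trans hux.le
        · exact (hb h m hm _).trans hux.le
    _ = ε := by field_simp; ring

/-- Powers `F(h)^j` are close to the identity, in the strong sense, when `j h` is small. -/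
theorem MemF.exists_pow_sub_le {F : ℝ≥0 → E →L[𝕜] E} (hF : MemF F) (y : E)
    {p : Seminorm 𝕜 E} (hp : Continuous p) {ε : ℝ} (hε : 0 < ε) :
    ∃ δ > (0 : ℝ≥0), ∀ᶠ h in 𝓝[>] (0 : ℝ≥0), ∀ j : ℕ, j * h ≤ δ → p ((F h ^ j) y - y) ≤ ε := by
  obtain ⟨q, hq, hb⟩ := hF.exists_bound 1 hp
  have hpq : ∀ x, p x ≤ q x := fun x => by simpa using hb 0 0 (by simp) x
  have hε' : 0 < ε / 4 := by positivity
  obtain ⟨z, hz, hzy⟩ := exists_near_of_dense hF.dense_domain y hq hε'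
  obtain ⟨z', hz'⟩ := (mem_effDeriv_domain F z).1 hz
  have hq0 : 0 ≤ q z' := apply_nonneg q z'
  have hq1 : (0 : ℝ) < q z' + 1 := by linarith
  refine ⟨min 1 (Real.toNNReal (ε / 4 / (q z' + 1))), ?_, ?_⟩
  · exact lt_min one_pos (Real.toNNReal_pos.2 (by positivity))
  have hcl : (z, z') ∈ (mefGraph F).topologicalClosure :=
    (mefGraph F).le_topologicalClosure hz'
  filter_upwards [hF.eventually_pow_sub_sum_le hcl 1 hp hε'] with h hh j hj
  have hj1 : j * h ≤ 1 := hj.trans (min_le_left _ _)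
  have hj2 : (j : ℝ) * h ≤ ε / 4 / (q z' + 1) := by
    have h3 : ((j * h : ℝ≥0) : ℝ) ≤ (Real.toNNReal (ε / 4 / (q z' + 1)) : ℝ) :=
      NNReal.coe_le_coe.2 (hj.trans (min_le_right _ _))
    rw [Real.coe_toNNReal _ (by positivity)] at h3
    simpa using h3
  have hs : p (∑ i ∈ Finset.range j, ((h : ℝ) : 𝕜) • (F h ^ i) z') ≤ ε / 4 := by
    calc _ ≤ j * h * q z' := seminorm_sum_le p h j _ fun i hi => hb h i (natCast_mul_le_of_le hi.le hj1) _
      _ ≤ ε / 4 / (q z' + 1) * (q z' + 1) := by gcongr; linarith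
      _ = ε / 4 := by field_simp
  have e1 : (F h ^ j) y - y = (z - y) - (F h ^ j) (z - y)
      + (((F h ^ j) z - z - ∑ i ∈ Finset.range j, ((h : ℝ) : 𝕜) • (F h ^ i) z')
        + ∑ i ∈ Finset.range j, ((h : ℝ) : 𝕜) • (F h ^ i) z') := by
    rw [map_sub]; abel
  rw [e1]
  calc _ ≤ (p (z - y) + p ((F h ^ j) (z - y))) + (ε / 4 + ε / 4) := by
        refine (map_add_le_add _ _ _).trans (add_le_add (map_sub_le_add _ _ _) ?_)
        exact (map_add_le_add _ _ _).trans (add_le_add (hh j hj1) hs)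
    _ ≤ (ε / 4 + ε / 4) + (ε / 4 + ε / 4) := by
        gcongr
        · exact (hpq _).trans hzy.le
        · exact (hb h j hj1 _).trans hzy.le
    _ = ε := by ring

/-- First-order expansion of `F(h)^m x` along the closure of the effective derivative. -/
theorem MemF.exists_pow_expansion {F : ℝ≥0 → E →L[𝕜] E} (hF : MemF F) {x y : E}
    (hxy : (x, y) ∈ (mefGraph F).topologicalClosure)
    {p : Seminorm 𝕜 E} (hp : Continuous p) {ε : ℝ} (hε : 0 < ε) :
    ∃ δ > (0 : ℝ≥0), ∀ η > 0, ∀ᶠ h in 𝓝[>] (0 : ℝ≥0), ∀ m : ℕ, m * h ≤ δ →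
      p ((F h ^ m) x - x - (((m * h : ℝ≥0) : ℝ) : 𝕜) • y) ≤ ε * (m * h) + η := by
  obtain ⟨δ, hδ, h1⟩ := hF.exists_pow_sub_le y hp hε
  refine ⟨δ, hδ, fun η hη => ?_⟩
  filter_upwards [h1, hF.eventually_pow_sub_sum_le hxy δ hp hη] with h h1 h2 m hm
  have e1 : (F h ^ m) x - x - (((m * h : ℝ≥0) : ℝ) : 𝕜) • y
      = ((F h ^ m) x - x - ∑ i ∈ Finset.range m, ((h : ℝ) : 𝕜) • (F h ^ i) y)
        + ∑ i ∈ Finset.range m, ((h : ℝ) : 𝕜) • ((F h ^ i) y - y) := by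
    simp only [smul_sub, Finset.sum_sub_distrib, Finset.sum_const, Finset.card_range]
    rw [← Nat.cast_smul_eq_nsmul 𝕜, smul_smul]
    push_cast
    abel
  rw [e1]
  calc _ ≤ η + m * h * ε := by
        refine (map_add_le_add _ _ _).trans (add_le_add (h2 m hm) ?_)
        exact seminorm_sum_le p h m _ fun i hi => h1 i (natCast_mul_le_of_le hi.le hm)
    _ = _ := by ring

theorem natFloor_mul_le {δ h : ℝ≥0} (hh : 0 < h) : (⌊δ / h⌋₊ : ℝ≥0) * h ≤ δ :=
  (mul_le_mul_left (Nat.floor_le (by positivity)) h).trans (by rw [div_mul_cancel₀ _ hh.ne'])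

theorem lt_natFloor_mul_add {δ h : ℝ≥0} (hh : 0 < h) : δ < (⌊δ / h⌋₊ : ℝ≥0) * h + h := by
  have := Nat.lt_floor_add_one (δ / h)
  rw [div_lt_iff₀ hh] at this
  linarith

theorem tendsto_coe_nhdsGT_zero :
    Tendsto (fun h : ℝ≥0 => (h : ℝ)) (𝓝[>] 0) (𝓝 0) :=
  (NNReal.continuous_coe.tendsto' 0 0 rfl).mono_left nhdsWithin_le_nhds

theorem eventually_nhdsGT_coe_le {ε : ℝ} (hε : 0 < ε) : ∀ᶠ h : ℝ≥0 in 𝓝[>] (0 : ℝ≥0), (h : ℝ) ≤ ε :=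
  tendsto_coe_nhdsGT_zero.eventually_le_const hε

/-- The closure of the effective derivative is single-valued. -/
theorem MemF.eq_zero_of_mem_closure [T2Space E] {F : ℝ≥0 → E →L[𝕜] E} (hF : MemF F) {y : E}
    (hy : (0, y) ∈ (mefGraph F).topologicalClosure) : y = 0 := by
  refine eq_zero_of_seminorm 𝕜 fun p hp => ?_
  refine le_antisymm (le_of_forall_pos_le_add fun ε hε => ?_) (apply_nonneg p y)
  rw [zero_add]
  obtain ⟨δ, hδ, H⟩ := hF.exists_pow_expansion hy hp (half_pos hε)
  have hδ' : (0 : ℝ) < δ := hδ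
  -- Take `m = ⌊δ / h⌋` and let `h → 0`, so that `m h → δ`.
  have hsm : 0 < ε / 4 * δ := by positivity
  have hsm' : 0 < ε / 4 * δ / (p y + 1) := by have := apply_nonneg p y; positivity
  obtain ⟨h, h1, h2, h0⟩ := ((H _ hsm).and ((eventually_nhdsGT_coe_le hsm').and
    self_mem_nhdsWithin)).exists
  have h0' : 0 < h := h0
  have h3 := h1 _ (natFloor_mul_le (δ := δ) h0)
  have h4 : ((⌊δ / h⌋₊ : ℝ≥0) * h : ℝ) ≤ δ := by exact_mod_cast natFloor_mul_le (δ := δ) h0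
  have h5 : (δ : ℝ) < ((⌊δ / h⌋₊ : ℝ≥0) * h : ℝ) + h := by
    exact_mod_cast lt_natFloor_mul_add (δ := δ) h0
  set M : ℝ := (⌊δ / h⌋₊ : ℝ≥0) * h with hM
  simp only [map_zero, sub_zero, zero_sub, map_neg_eq_map] at h3
  rw [seminorm_real_smul] at h3
  have h6 : M * p y ≤ ε / 2 * M + ε / 4 * δ := by simpa [hM] using h3
  have h7 : (h : ℝ) * p y ≤ ε / 4 * δ := by
    calc (h : ℝ) * p y ≤ ε / 4 * δ / (p y + 1) * (p y + 1) := by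
          have := apply_nonneg p y
          gcongr; linarith
      _ = _ := by have := apply_nonneg p y; field_simp
  have h8 : (δ : ℝ) * p y ≤ δ * ε := by
    have := mul_le_mul_of_nonneg_right h5.le (apply_nonneg p y)
    nlinarith
  exact le_of_mul_le_mul_left h8 hδ'

theorem MemF.subsingleton_mefDeriv [T2Space E] {F : ℝ≥0 → E →L[𝕜] E} (hF : MemF F) (f : E) :
    (mefDeriv F f).Subsingleton := by
  intro g hg g' hg'
  have h : ((f, g) : E × E) - (f, g') ∈ mefGraph F := (mefGraph F).sub_mem hg hg'
  have h' : ((0, g - g') : E × E) ∈ (mefGraph F).topologicalClosure := by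
    simpa using (mefGraph F).le_topologicalClosure h
  exact sub_eq_zero.1 (hF.eq_zero_of_mem_closure h')

theorem MemF.graph_le_mefGraph [T2Space E] {F : ℝ≥0 → E →L[𝕜] E} (hF : MemF F)
    {Z : E →ₗ.[𝕜] E} (hZ : Z ≤ effDeriv F) : Z.graph ≤ mefGraph F := by
  rintro ⟨x, y⟩ hxy
  have h := LinearPMap.le_graph_of_le hZ hxy
  rw [LinearPMap.mem_graph_iff] at h
  obtain ⟨z, rfl, rfl⟩ := h
  exact effDeriv_mem F hF.subsingleton_mefDeriv z

theorem MemF.isClosable [T2Space E] {F : ℝ≥0 → E →L[𝕜] E} (hF : MemF F)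
    {Z : E →ₗ.[𝕜] E} (hZ : Z ≤ effDeriv F) : Z.IsClosable := by
  refine ⟨Z.graph.topologicalClosure.toLinearPMap, ?_⟩
  rw [Submodule.toLinearPMap_graph_eq]
  rintro ⟨x, y⟩ hxy hx
  obtain rfl : x = 0 := hx
  exact hF.eq_zero_of_mem_closure
    (Submodule.topologicalClosure_mono (hF.graph_le_mefGraph hZ) hxy)

theorem MemF.closure_graph_le [T2Space E] {F : ℝ≥0 → E →L[𝕜] E} (hF : MemF F)
    {Z : E →ₗ.[𝕜] E} (hZ : Z ≤ effDeriv F) :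
    Z.closure.graph ≤ (mefGraph F).topologicalClosure := by
  rw [← (hF.isClosable hZ).graph_closure_eq_closure_graph]
  exact Submodule.topologicalClosure_mono (hF.graph_le_mefGraph hZ)

end Powers

/-! ### Integer parts of time quotients -/

section Floor

theorem natFloor_div_mono {r r' : ℝ≥0} (h : ℝ≥0) (hr : r ≤ r') : ⌊r / h⌋₊ ≤ ⌊r' / h⌋₊ :=
  Nat.floor_mono (by gcongr)

theorem natFloor_sub_mul_le {r s : ℝ≥0} {h : ℝ≥0} (hh : 0 < h) :
    ((⌊s / h⌋₊ - ⌊r / h⌋₊ : ℕ) : ℝ≥0) * h ≤ s :=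
  natCast_mul_le_of_le (Nat.sub_le _ _) (natFloor_mul_le hh)

theorem abs_natFloor_sub_mul_sub_le {r d : ℝ≥0} {h : ℝ≥0} (hh : 0 < h) :
    |((⌊(r + d) / h⌋₊ - ⌊r / h⌋₊ : ℕ) : ℝ) * h - d| ≤ h := by
  have h1 : ((⌊(r + d) / h⌋₊ : ℝ≥0) * h : ℝ) ≤ r + d := by
    exact_mod_cast natFloor_mul_le (δ := r + d) hh
  have h2 : ((r + d : ℝ≥0) : ℝ) < ((⌊(r + d) / h⌋₊ : ℝ≥0) * h : ℝ) + h := by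
    exact_mod_cast lt_natFloor_mul_add (δ := r + d) hh
  have h3 : ((⌊r / h⌋₊ : ℝ≥0) * h : ℝ) ≤ r := by
    exact_mod_cast natFloor_mul_le (δ := r) hh
  have h4 : (r : ℝ) < ((⌊r / h⌋₊ : ℝ≥0) * h : ℝ) + h := by
    exact_mod_cast lt_natFloor_mul_add (δ := r) hh
  rw [Nat.cast_sub (natFloor_div_mono h (le_add_of_nonneg_right d.2))]
  push_cast at *
  rw [abs_le]
  constructor <;> linarith

theorem natFloor_sub_mul_le_add {r r' : ℝ≥0} {h : ℝ≥0} (hh : 0 < h) (hr : r ≤ r') :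
    ((⌊r' / h⌋₊ - ⌊r / h⌋₊ : ℕ) : ℝ≥0) * h ≤ (r' - r) + h := by
  have h1 := (abs_le.1 (abs_natFloor_sub_mul_sub_le (r := r) (d := r' - r) hh)).2
  rw [add_tsub_cancel_of_le hr] at h1
  rw [← NNReal.coe_le_coe, NNReal.coe_mul, NNReal.coe_natCast, NNReal.coe_add]
  linarith

end Floor

/-! ### Chernoff approximation of classical solutions -/

section Chernoff

variable {𝕜 E : Type*} [RCLike 𝕜] [AddCommGroup E] [Module 𝕜 E] [UniformSpace E]
  [IsUniformAddGroup E] [ContinuousSMul 𝕜 E] [PolynormableSpace 𝕜 E]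

variable (𝕜) in
/-- `y` is the right derivative of `u : [0, ∞) → E` at `r`. -/
def HasRightDeriv (u : ℝ≥0 → E) (y : E) (r : ℝ≥0) : Prop :=
  Tendsto (fun d : ℝ≥0 => ((d : ℝ) : 𝕜)⁻¹ • (u (r + d) - u r)) (𝓝[>] 0) (𝓝 y)

omit [UniformSpace E] [IsUniformAddGroup E] [ContinuousSMul 𝕜 E] [PolynormableSpace 𝕜 E] in
theorem seminorm_smul_inv_sub (p : Seminorm 𝕜 E) {d : ℝ≥0} (hd : 0 < d) (x y : E) :
    d * p (((d : ℝ) : 𝕜)⁻¹ • x - y) = p (x - ((d : ℝ) : 𝕜) • y) := by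
  have hd' : ((d : ℝ) : 𝕜) ≠ 0 := by simpa using hd.ne'
  rw [← seminorm_real_smul, smul_sub, smul_smul, mul_inv_cancel₀ hd', one_smul]

theorem nnreal_exists_of_eventually {P : ℝ≥0 → Prop} (h : ∀ᶠ d in 𝓝[>] (0 : ℝ≥0), P d) :
    ∃ δ > 0, ∀ d, 0 < d → d ≤ δ → P d := by
  obtain ⟨δ, hδ, H⟩ := (mem_nhdsGT_iff_exists_Ioc_subset (a := (0 : ℝ≥0))).1 h
  exact ⟨δ, hδ, fun d h1 h2 => H ⟨h1, h2⟩⟩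

omit [IsUniformAddGroup E] [ContinuousSMul 𝕜 E] in
theorem hasRightDeriv_iff {u : ℝ≥0 → E} {y : E} {r : ℝ≥0} :
    HasRightDeriv 𝕜 u y r ↔ ∀ p : Seminorm 𝕜 E, Continuous p → ∀ ε > 0, ∃ δ > (0 : ℝ≥0),
      ∀ d ≤ δ, p (u (r + d) - u r - ((d : ℝ) : 𝕜) • y) ≤ ε * d := by
  rw [HasRightDeriv, tendsto_iff_seminorm 𝕜]
  refine forall₂_congr fun p hp => ⟨fun H ε hε => ?_, fun H ε hε => ?_⟩
  · obtain ⟨δ, hδ, h⟩ := nnreal_exists_of_eventually (H ε hε)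
    refine ⟨δ, hδ, fun d hd => ?_⟩
    rcases eq_or_lt_of_le (zero_le (a := d)) with rfl | hd0
    · simp
    · rw [← seminorm_smul_inv_sub p hd0, mul_comm]
      exact mul_le_mul_of_nonneg_right (h d hd0 hd).le d.2
  · obtain ⟨δ, hδ, h⟩ := H (ε / 2) (half_pos hε)
    filter_upwards [Ioc_mem_nhdsGT hδ] with d hd
    have h1 := h d hd.2
    rw [← seminorm_smul_inv_sub p hd.1, mul_comm] at h1
    have := le_of_mul_le_mul_right h1 hd.1
    linarith

/-- Asymptotic equicontinuity in time of the step evolutions `s ↦ F(h)^⌊s/h⌋ f`. -/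
theorem MemF.exists_step_sub_le {F : ℝ≥0 → E →L[𝕜] E} (hF : MemF F) (f : E) (s : ℝ≥0)
    {p : Seminorm 𝕜 E} (hp : Continuous p) {ε : ℝ} (hε : 0 < ε) :
    ∃ δ > (0 : ℝ≥0), ∀ r r', r ≤ s → r ≤ r' → r' ≤ r + δ → ∀ᶠ h in 𝓝[>] (0 : ℝ≥0),
      p ((F h ^ ⌊r' / h⌋₊) f - (F h ^ ⌊r / h⌋₊) f) ≤ ε := by
  obtain ⟨q, hq, hb⟩ := hF.exists_bound s hp
  obtain ⟨δ, hδ, H⟩ := hF.exists_pow_sub_le f hq hε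
  refine ⟨δ / 2, by positivity, fun r r' hr hrr hr' => ?_⟩
  filter_upwards [H, Ioc_mem_nhdsGT (show 0 < δ / 2 by positivity)] with h hh hhδ
  have h1 : ⌊r' / h⌋₊ = ⌊r / h⌋₊ + (⌊r' / h⌋₊ - ⌊r / h⌋₊) :=
    (Nat.add_sub_of_le (natFloor_div_mono h hrr)).symm
  rw [h1, pow_add, mul_apply_eq_comp, ← map_sub]
  refine (hb h _ ((natFloor_mul_le hhδ.1).trans hr) _).trans (hh _ ?_)
  calc _ ≤ (r' - r) + h := natFloor_sub_mul_le_add hhδ.1 hrr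
    _ ≤ δ / 2 + δ / 2 := add_le_add (tsub_le_iff_left.2 hr') hhδ.2
    _ = δ := add_halves δ

/-- **Chernoff approximation of a given solution.** If `u` is continuous, right differentiable, and
`(u(r), u'(r))` always belongs to the closure of the effective derivative of `F`, then
`F(h)^⌊s/h⌋ u(0) → u(s)` as `h → 0`. The proof follows the error of `F(h)^(⌊s/h⌋-⌊r/h⌋) u(r)`
along `r ∈ [0, s]` by continuous induction. -/
theorem MemF.tendsto_step {F : ℝ≥0 → E →L[𝕜] E} (hF : MemF F) {u y : ℝ≥0 → E}
    (hu : Continuous u) (hy : ∀ r, (u r, y r) ∈ (mefGraph F).topologicalClosure)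
    (hd : ∀ r, HasRightDeriv 𝕜 u (y r) r) (s : ℝ≥0) :
    Tendsto (fun h => (F h ^ ⌊s / h⌋₊) (u 0)) (𝓝[>] 0) (𝓝 (u s)) := by
  refine (tendsto_iff_seminorm 𝕜).2 fun p hp ε hε => ?_
  obtain ⟨q, hq, hb⟩ := hF.exists_bound s hp
  obtain ⟨q2, hq2, hb2⟩ := hF.exists_bound s hq
  have hqq2 : ∀ x, q x ≤ q2 x := fun x => by simpa using hb2 0 0 (by simp) x
  set N : ℝ≥0 → ℝ≥0 → ℕ := fun h r => ⌊r / h⌋₊ with hN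
  have hNs : ∀ {h : ℝ≥0} (_ : 0 < h) (r : ℝ≥0) x, p ((F h ^ (N h s - N h r)) x) ≤ q x :=
    fun {h} hh r x => hb h _ (natFloor_sub_mul_le hh) x
  have hsplit : ∀ h {r r' : ℝ≥0}, r ≤ r' → r' ≤ s → ∀ x,
      (F h ^ (N h s - N h r)) x = (F h ^ (N h s - N h r')) ((F h ^ (N h r' - N h r)) x) := by
    intro h r r' hr hr' x
    have h1 := natFloor_div_mono h hr
    have h2 := natFloor_div_mono h hr'
    rw [← mul_apply_eq_comp, ← pow_add]
    congr 2
    simp only [hN]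
    omega
  set G : ℝ≥0 → ℝ≥0 → E := fun h r => (F h ^ (N h s - N h r)) (u r) with hG
  have hε1 : 0 < ε / (2 * (s + 1)) := by positivity
  set ε1 := ε / (2 * (s + 1)) with hε1def
  -- `G h` interpolates between `F(h)^⌊s/h⌋ u(0)` at `r = 0` and `u(s)` at `r = s`; the set `S` of
  -- times up to which it moves by at most `ε₁ r` in the limit is shown to contain `[0, s]`.
  let S : Set ℝ≥0 := {r | ∀ η > 0, ∀ᶠ h in 𝓝[>] (0 : ℝ≥0), p (G h r - G h 0) ≤ ε1 * r + η}
  -- Continuity of `G`, asymptotically as `h → 0`.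
  have hcont : ∀ r ≤ s, ∀ η > 0, ∀ᶠ r' in 𝓝 r, r' ≤ s →
      ∀ᶠ h in 𝓝[>] (0 : ℝ≥0), p (G h r - G h r') ≤ η := by
    intro r hr η hη
    obtain ⟨δ, hδ, H⟩ := hF.exists_pow_sub_le (u r) hq (half_pos hη)
    have h1 : ∀ᶠ r' in 𝓝 r, q2 (u r' - u r) < η / 2 :=
      (tendsto_iff_seminorm 𝕜).1 (hu.tendsto r) q2 hq2 _ (half_pos hη)
    have hδ2 : 0 < δ / 2 := by positivity
    have h2 : ∀ᶠ r' in 𝓝 r, r' < r + δ / 2 := eventually_lt_nhds (lt_add_of_pos_right r hδ2)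
    have h3 : ∀ᶠ r' in 𝓝 r, r < r' + δ / 2 :=
      (continuous_id.add continuous_const).tendsto r |>.eventually_const_lt
        (lt_add_of_pos_right r hδ2)
    filter_upwards [h1, h2, h3] with r' h1 h2 h3 hr'
    filter_upwards [H, Ioc_mem_nhdsGT hδ2] with h hh hhδ
    rcases le_total r r' with hrr | hrr
    · have e : G h r - G h r' = (F h ^ (N h s - N h r'))
          (((F h ^ (N h r' - N h r)) (u r) - u r) - (u r' - u r)) := by
        simp only [hG, hsplit h hrr hr', map_sub]; abel
      rw [e]
      refine (hNs hhδ.1 _ _).trans ((map_sub_le_add _ _ _).trans ?_)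
      have h4 := hh (N h r' - N h r) <| (natFloor_sub_mul_le_add hhδ.1 hrr).trans <|
        (add_le_add (tsub_le_iff_left.2 h2.le) hhδ.2).trans_eq (add_halves δ)
      have h5 := hqq2 (u r' - u r)
      linarith
    · have e : G h r - G h r' = -(F h ^ (N h s - N h r))
          (((F h ^ (N h r - N h r')) (u r) - u r) + (F h ^ (N h r - N h r')) (u r' - u r)) := by
        simp only [hG, hsplit h hrr hr, map_sub, map_add]; abel
      rw [e, map_neg_eq_map]
      refine (hNs hhδ.1 _ _).trans ((map_add_le_add _ _ _).trans ?_)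
      have h4 := hh (N h r - N h r') <| (natFloor_sub_mul_le_add hhδ.1 hrr).trans <|
        (add_le_add (tsub_le_iff_left.2 h3.le) hhδ.2).trans_eq (add_halves δ)
      have h5 := hb2 h (N h r - N h r') ((natFloor_sub_mul_le hhδ.1).trans hr) (u r' - u r)
      linarith
  have hclosed : IsClosed (S ∩ Set.Icc 0 s) := by
    refine isClosed_of_closure_subset fun r hr => ?_
    have hrs : r ∈ Set.Icc 0 s := isClosed_Icc.closure_subset_iff.2 Set.inter_subset_right hr
    refine ⟨fun η hη => ?_, hrs⟩
    have hlim : ∀ᶠ r' : ℝ≥0 in 𝓝 r, ε1 * (r' : ℝ) < ε1 * r + η / 3 :=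
      (show Continuous fun r' : ℝ≥0 => ε1 * (r' : ℝ) by fun_prop).tendsto r
        |>.eventually_lt_const (by linarith)
    obtain ⟨r', hr', h1, h2⟩ := ((mem_closure_iff_frequently.1 hr).and_eventually
      ((hcont r hrs.2 (η / 3) (by linarith)).and hlim)).exists
    filter_upwards [h1 hr'.2.2, hr'.1 (η / 3) (by linarith)] with h h3 h4
    have h5 : p (G h r - G h 0) ≤ p (G h r - G h r') + p (G h r' - G h 0) := by
      refine le_trans (le_of_eq ?_) (map_add_le_add _ _ _)
      congr 1; abel
    linarith
  have h0 : (0 : ℝ≥0) ∈ S := fun η hη => by simp [hη.le]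
  -- Over a short step the right derivative of `u` and the expansion of `F(h)^k u(r)` have the same
  -- linear term, which cancels.
  have hstep : ∀ r ∈ S ∩ Set.Ico 0 s, ∀ b ∈ Set.Ioi r, (S ∩ Set.Ioc r b).Nonempty := by
    rintro r ⟨hrS, -, hrs⟩ b (hb' : r < b)
    obtain ⟨δ1, hδ1, H1⟩ := hasRightDeriv_iff.1 (hd r) q hq (ε1 / 4) (by positivity)
    obtain ⟨δ2, hδ2, H2⟩ := hF.exists_pow_expansion (hy r) hq
      (show 0 < ε1 / 4 by positivity)
    obtain ⟨d, hd0, hdδ⟩ : ∃ d : ℝ≥0, 0 < d ∧ d ≤ min (min δ1 (δ2 / 2)) (min (b - r) (s - r)) :=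
      ⟨_, lt_min (lt_min hδ1 (by positivity)) (lt_min (tsub_pos_of_lt hb') (tsub_pos_of_lt hrs)),
        le_rfl⟩
    simp only [le_min_iff] at hdδ
    obtain ⟨⟨hd1, hd2⟩, hdb, hds⟩ := hdδ
    have hd0' : (0 : ℝ) < d := hd0
    have hrds : r + d ≤ s := by
      rw [← add_tsub_cancel_of_le hrs.le]; gcongr
    refine ⟨r + d, fun η hη => ?_, lt_add_of_pos_right r hd0, ?_⟩
    swap
    · rw [← add_tsub_cancel_of_le hb'.le]; gcongr
    have hqy := apply_nonneg q (y r)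
    filter_upwards [hrS η hη, H2 (ε1 / 8 * d) (by positivity), self_mem_nhdsWithin,
      Ioc_mem_nhdsGT (show 0 < δ2 / 2 by positivity), Ioc_mem_nhdsGT hd0,
      eventually_nhdsGT_coe_le (show 0 < ε1 / 8 * d / (q (y r) + 1) by positivity)]
      with h h1 h2 h0 h3 hhd h4
    have h0 : 0 < h := h0
    have hk := abs_natFloor_sub_mul_sub_le (r := r) (d := d) h0
    set k := N h (r + d) - N h r with hkdef
    have hkd : (k : ℝ≥0) * h ≤ d + h := by
      have := natFloor_sub_mul_le_add h0 (le_add_of_nonneg_right d.2 : r ≤ r + d)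
      rwa [add_tsub_cancel_left] at this
    have hkd' : (k : ℝ) * h ≤ d + h := by exact_mod_cast hkd
    have hhd' : (h : ℝ) ≤ d := hhd.2
    have e : G h (r + d) - G h r = (F h ^ (N h s - N h (r + d)))
        ((u (r + d) - u r - ((d : ℝ) : 𝕜) • y r)
          - ((F h ^ k) (u r) - u r - (((k * h : ℝ≥0) : ℝ) : 𝕜) • y r)
          - ((((k * h : ℝ≥0) : ℝ) : 𝕜) - ((d : ℝ) : 𝕜)) • y r) := by
      simp only [hG, hsplit h (le_add_of_nonneg_right d.2 : r ≤ r + d) hrds]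
      rw [← map_sub]
      congr 1
      rw [sub_smul]
      abel
    have h5 : p (G h (r + d) - G h r) ≤ ε1 * d := by
      rw [e]
      refine (hNs h0 _ _).trans ((map_sub_le_add _ _ _).trans ?_)
      have h6 : q (((((k * h : ℝ≥0) : ℝ) : 𝕜) - ((d : ℝ) : 𝕜)) • y r) ≤ h * q (y r) := by
        rw [map_smul_eq_mul, ← RCLike.ofReal_sub, RCLike.norm_ofReal]
        gcongr
        push_cast
        exact hk
      have h7 : (h : ℝ) * q (y r) ≤ ε1 / 8 * d := by
        calc (h : ℝ) * q (y r) ≤ ε1 / 8 * d / (q (y r) + 1) * (q (y r) + 1) := by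
              gcongr; linarith
          _ = _ := by field_simp
      have h8 := H1 d hd1
      have h9 := h2 k (hkd.trans ((add_le_add hd2 h3.2).trans_eq (add_halves δ2)))
      have h10 : ε1 / 4 * (k * h) ≤ ε1 / 4 * (d + d) := by
        gcongr; linarith
      have h11 := map_sub_le_add q (u (r + d) - u r - ((d : ℝ) : 𝕜) • y r)
        ((F h ^ k) (u r) - u r - (((k * h : ℝ≥0) : ℝ) : 𝕜) • y r)
      linarith
    have h12 : p (G h (r + d) - G h 0) ≤ p (G h (r + d) - G h r) + p (G h r - G h 0) := by
      refine le_trans (le_of_eq ?_) (map_add_le_add _ _ _)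
      congr 1; abel
    push_cast
    linarith
  have hs : s ∈ S :=
    hclosed.Icc_subset_of_forall_exists_gt h0 hstep ⟨zero_le, le_rfl⟩
  filter_upwards [hs (ε / 4) (by linarith)] with h h1
  have e1 : G h s = u s := by simp [hG]
  have e2 : G h 0 = (F h ^ ⌊s / h⌋₊) (u 0) := by simp [hG, hN]
  rw [e1, e2, map_sub_rev] at h1
  have h2 : ε1 * s ≤ ε / 2 := by
    rw [hε1def, div_mul_eq_mul_div, div_le_div_iff₀ (by positivity) (by norm_num)]
    nlinarith
  linarith

/-- By equicontinuity, step evolutions are Cauchy on all of `E` once they are so on a dense set. -/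
theorem MemE.cauchy_step_of_dense {F : ℝ≥0 → E →L[𝕜] E} (hF : MemE F) (s : ℝ≥0) {A : Set E}
    (hA : Dense A) (h : ∀ f ∈ A, Cauchy (map (fun h => (F h ^ ⌊s / h⌋₊) f) (𝓝[>] 0))) (f : E) :
    Cauchy (map (fun h => (F h ^ ⌊s / h⌋₊) f) (𝓝[>] (0 : ℝ≥0))) := by
  rw [IsUniformAddGroup.cauchy_map_iff_tendsto]
  refine ⟨inferInstance, (tendsto_iff_seminorm 𝕜).2 fun p hp ε hε => ?_⟩
  obtain ⟨q, hq, hb⟩ := hF.exists_bound s hp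
  obtain ⟨g, hg, hgf⟩ := exists_near_of_dense hA f hq (show 0 < ε / 4 by positivity)
  have h1 := (tendsto_iff_seminorm 𝕜).1
    ((IsUniformAddGroup.cauchy_map_iff_tendsto _ _).1 (h g hg)).2 p hp (ε / 4) (by positivity)
  have h2 : ∀ᶠ x : ℝ≥0 × ℝ≥0 in 𝓝[>] 0 ×ˢ 𝓝[>] 0, 0 < x.1 ∧ 0 < x.2 :=
    prod_mem_prod self_mem_nhdsWithin self_mem_nhdsWithin
  filter_upwards [h1, h2] with x hx hx0
  have h3 := hb x.1 _ (natFloor_mul_le hx0.1) (g - f)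
  have h4 := hb x.2 _ (natFloor_mul_le hx0.2) (g - f)
  rw [sub_zero] at hx ⊢
  have e : (F x.1 ^ ⌊s / x.1⌋₊) f - (F x.2 ^ ⌊s / x.2⌋₊) f
      = ((F x.1 ^ ⌊s / x.1⌋₊) g - (F x.2 ^ ⌊s / x.2⌋₊) g)
        - ((F x.1 ^ ⌊s / x.1⌋₊) (g - f) - (F x.2 ^ ⌊s / x.2⌋₊) (g - f)) := by
    simp only [map_sub]; abel
  rw [e]
  have h5 := map_sub_le_add p ((F x.1 ^ ⌊s / x.1⌋₊) (g - f)) ((F x.2 ^ ⌊s / x.2⌋₊) (g - f))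
  refine (map_sub_le_add _ _ _).trans_lt ?_
  linarith

/-- By equicontinuity, convergence of step evolutions to a continuous operator extends from a dense
set to all of `E`. -/
theorem MemE.tendsto_step_of_dense {F : ℝ≥0 → E →L[𝕜] E} (hF : MemE F) (s : ℝ≥0) {A : Set E}
    (hA : Dense A) (B : E →L[𝕜] E)
    (h : ∀ f ∈ A, Tendsto (fun h => (F h ^ ⌊s / h⌋₊) f) (𝓝[>] 0) (𝓝 (B f))) (f : E) :
    Tendsto (fun h => (F h ^ ⌊s / h⌋₊) f) (𝓝[>] (0 : ℝ≥0)) (𝓝 (B f)) := by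
  refine (tendsto_iff_seminorm 𝕜).2 fun p hp ε hε => ?_
  obtain ⟨q, hq, hb⟩ := hF.exists_bound s hp
  have hpB : Continuous (p.comp (B : E →ₗ[𝕜] E)) := hp.comp B.continuous
  obtain ⟨g, hg, hgf⟩ := exists_near_of_dense hA f
    (p := q ⊔ p.comp (B : E →ₗ[𝕜] E)) (hq.sup hpB) (show 0 < ε / 4 by positivity)
  have hgf' : max (q (g - f)) (p (B (g - f))) < ε / 4 := hgf
  rw [max_lt_iff] at hgf'
  filter_upwards [(tendsto_iff_seminorm 𝕜).1 (h g hg) p hp (ε / 4) (by positivity),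
    self_mem_nhdsWithin] with x hx hx0
  have h3 := hb x _ (natFloor_mul_le hx0) (g - f)
  have e : (F x ^ ⌊s / x⌋₊) f - B f
      = ((F x ^ ⌊s / x⌋₊) g - B g) - ((F x ^ ⌊s / x⌋₊) (g - f) - B (g - f)) := by
    simp only [map_sub]; abel
  rw [e]
  have h5 := map_sub_le_add p ((F x ^ ⌊s / x⌋₊) (g - f)) (B (g - f))
  refine (map_sub_le_add _ _ _).trans_lt ?_
  linarith

end Chernoff

/-! ### Consequences of the Hahn-Banach theorem -/

section HahnBanach

variable {𝕜 E : Type*} [RCLike 𝕜] [AddCommGroup E] [Module 𝕜 E] [TopologicalSpace E]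
  [PolynormableSpace 𝕜 E]

/-- A norming functional for a continuous seminorm at a point. -/
theorem exists_dual_eq_seminorm {p : Seminorm 𝕜 E} (hp : Continuous p) (x : E) :
    ∃ φ : StrongDual 𝕜 E, ‖φ x‖ = p x ∧ ∀ y, ‖φ y‖ ≤ p y := by
  by_cases hx : p x = 0
  · exact ⟨0, by simp [hx], fun y => by simp⟩
  have hx0 : x ≠ 0 := fun h => hx (by simp [h])
  let f : E →ₗ.[𝕜] 𝕜 := LinearPMap.mkSpanSingleton x ((p x : ℝ) : 𝕜) hx0
  have hf : ∀ y : f.domain, ‖f.toFun y‖ ≤ p y := by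
    rintro ⟨y, hy⟩
    obtain ⟨c, rfl⟩ := Submodule.mem_span_singleton.1 hy
    have : f ⟨c • x, hy⟩ = c • ((p x : ℝ) : 𝕜) := LinearPMap.mkSpanSingleton'_apply _ _ _ _ _
    simp only [LinearPMap.toFun_eq_coe, this, norm_smul, RCLike.norm_ofReal, map_smul_eq_mul,
      abs_of_nonneg (apply_nonneg p x), le_refl]
  obtain ⟨φ, h1, h2⟩ := Module.Dual.exists_continuous_extension_of_le_seminorm f.domain f.toFun hp hf
  refine ⟨φ, ?_, h2⟩
  have hxm : x ∈ f.domain := Submodule.mem_span_singleton_self x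
  have h3 := h1 ⟨x, hxm⟩
  have : f ⟨x, hxm⟩ = ((p x : ℝ) : 𝕜) := LinearPMap.mkSpanSingleton'_apply_self _ _ _ _
  simp only [LinearPMap.toFun_eq_coe, this] at h3
  rw [h3, RCLike.norm_ofReal, abs_of_nonneg (apply_nonneg p x)]

variable (𝕜) in
theorem eq_of_forall_dual_eq [IsTopologicalAddGroup E] [T2Space E] {x y : E}
    (h : ∀ φ : StrongDual 𝕜 E, φ x = φ y) : x = y := by
  refine sub_eq_zero.1 (eq_zero_of_seminorm 𝕜 fun p hp => ?_)
  obtain ⟨φ, h1, -⟩ := exists_dual_eq_seminorm hp (x - y)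
  rw [← h1, map_sub, h φ, sub_self, norm_zero]

/-- Membership in a closed subspace is detected by the functionals vanishing on it. -/
theorem mem_of_forall_dual_eq_zero [IsTopologicalAddGroup E] [ContinuousSMul 𝕜 E]
    {S : Submodule 𝕜 E} (hS : IsClosed (S : Set E)) {z : E}
    (h : ∀ φ : StrongDual 𝕜 E, (∀ w ∈ S, φ w = 0) → φ z = 0) : z ∈ S := by
  let _ : Module ℝ E := Module.restrictScalars ℝ 𝕜 E
  have _ : IsScalarTower ℝ 𝕜 E := IsScalarTower.restrictScalars _ _ _
  have _ : LocallyConvexSpace ℝ E := (PolynormableSpace.withSeminorms 𝕜 E).toLocallyConvexSpace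
  by_contra hz
  obtain ⟨φ, u, h1, h2⟩ := RCLike.geometric_hahn_banach_point_closed (𝕜 := 𝕜)
    (S.restrictScalars ℝ).convex hS hz
  have hre : ∀ w ∈ S, RCLike.re (φ w) = 0 := by
    intro w hw
    by_contra hne
    have h3 := h2 ((((u - 1) / RCLike.re (φ w) : ℝ) : 𝕜) • w) (S.smul_mem _ hw)
    rw [map_smul, smul_eq_mul, RCLike.re_ofReal_mul, div_mul_cancel₀ _ hne] at h3
    linarith
  have hφ : ∀ w ∈ S, φ w = 0 := by
    intro w hw
    refine RCLike.ext_iff.2 ⟨by simpa using hre w hw, ?_⟩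
    have h3 := hre (RCLike.I • w : E) (S.smul_mem _ hw)
    rw [map_smul, smul_eq_mul, RCLike.I_mul_re] at h3
    simpa using h3
  have h0 := h2 0 S.zero_mem
  rw [h φ hφ] at h1
  simp at h0 h1
  linarith

end HahnBanach

/-! ### Weak integrals of continuous curves -/

section Integral

theorem norm_riemannSum_sub_integral_le {𝕜 : Type*} [RCLike 𝕜] {g : ℝ → 𝕜} (hg : Continuous g)
    {n : ℕ} (hn : 0 < n) {ε : ℝ}
    (h : ∀ x ∈ Set.Icc (0 : ℝ) 1, ∀ y ∈ Set.Icc (0 : ℝ) 1, |x - y| ≤ 1 / n → ‖g x - g y‖ ≤ ε) :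
    ‖(∑ j ∈ Finset.range n, ((1 / n : ℝ) : 𝕜) * g (j / n)) - ∫ x in (0 : ℝ)..1, g x‖ ≤ ε := by
  have hn' : (0 : ℝ) < n := by exact_mod_cast hn
  have e1 : ∫ x in (0 : ℝ)..1, g x
      = ∑ j ∈ Finset.range n, ∫ x in ((j : ℝ) / n)..((j + 1 : ℕ) : ℝ) / n, g x := by
    rw [intervalIntegral.sum_integral_adjacent_intervals (a := fun j : ℕ => (j : ℝ) / n)
      (fun k _ => hg.intervalIntegrable _ _)]
    simp [hn'.ne']
  have e2 : ∀ j : ℕ, ((1 / n : ℝ) : 𝕜) * g (j / n)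
      = ∫ _x in ((j : ℝ) / n)..((j + 1 : ℕ) : ℝ) / n, g (j / n) := by
    intro j
    rw [intervalIntegral.integral_const, RCLike.real_smul_eq_coe_mul]
    congr 2
    push_cast
    field_simp
    ring
  rw [e1, ← Finset.sum_sub_distrib]
  calc _ ≤ ∑ j ∈ Finset.range n, ε * (1 / n) := by
        refine (norm_sum_le _ _).trans (Finset.sum_le_sum fun j hj => ?_)
        have hj' : ((j : ℝ) + 1) ≤ n := by exact_mod_cast Finset.mem_range.1 hj
        rw [e2, ← intervalIntegral.integral_sub (by simp) (hg.intervalIntegrable _ _)]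
        have hle : (j : ℝ) / n ≤ ((j + 1 : ℕ) : ℝ) / n := by gcongr; simp
        have e3 : ((j + 1 : ℕ) : ℝ) / n - (j : ℝ) / n = 1 / n := by push_cast; ring
        refine (intervalIntegral.norm_integral_le_of_norm_le_const (C := ε) ?_).trans_eq ?_
        · intro x hx
          rw [Set.uIoc_of_le hle] at hx
          have h1 : ((j + 1 : ℕ) : ℝ) / n ≤ 1 := by
            rw [div_le_one hn']; exact_mod_cast hj'
          have h0 : (0 : ℝ) ≤ (j : ℝ) / n := by positivity
          refine h _ ⟨h0, hle.trans h1⟩ _ ⟨h0.trans hx.1.le, hx.2.trans h1⟩ ?_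
          rw [abs_sub_comm, abs_of_nonneg (by linarith [hx.1])]
          linarith [hx.2]
        · rw [e3, abs_of_nonneg (by positivity)]
    _ = ε := by simp; field_simp

variable {𝕜 E : Type*} [RCLike 𝕜] [AddCommGroup E] [Module 𝕜 E] [UniformSpace E]
  [IsUniformAddGroup E] [ContinuousSMul 𝕜 E] [PolynormableSpace 𝕜 E]

variable (𝕜) in
/-- `I` is the weak (Pettis) integral of `v` over `[0, a]`. -/
def IsWeakIntegral (v : ℝ≥0 → E) (a : ℝ≥0) (I : E) : Prop :=
  ∀ φ : StrongDual 𝕜 E, φ I = ∫ r in (0 : ℝ)..a, φ (v r.toNNReal)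

omit [IsUniformAddGroup E] [ContinuousSMul 𝕜 E] [PolynormableSpace 𝕜 E] in
theorem continuous_dual_comp {v : ℝ≥0 → E} (hv : Continuous v) (φ : StrongDual 𝕜 E) :
    Continuous fun r : ℝ => φ (v r.toNNReal) :=
  φ.continuous.comp (hv.comp continuous_real_toNNReal)

omit [ContinuousSMul 𝕜 E] in
variable (𝕜) in
/-- Continuous functions into a complete locally convex space are weakly integrable: their Riemann
sums form a Cauchy sequence. -/
theorem exists_isWeakIntegral [CompleteSpace E] {v : ℝ≥0 → E} (hv : Continuous v) (a : ℝ≥0) :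
    ∃ I, IsWeakIntegral 𝕜 v a I := by
  let w : ℝ → E := fun x => v (a * x).toNNReal
  have hw : Continuous w := hv.comp (continuous_real_toNNReal.comp (by fun_prop))
  let R : ℕ → E := fun n => ∑ j ∈ Finset.range n, ((1 / n : ℝ) : 𝕜) • w (j / n)
  have huc := isCompact_Icc (a := (0 : ℝ)) (b := 1) |>.uniformContinuousOn_of_continuous
    hw.continuousOn
  -- For functionals dominated by `p`, the Riemann sums converge uniformly.
  have key : ∀ p : Seminorm 𝕜 E, Continuous p → ∀ ε > 0, ∀ᶠ n in atTop,
      ∀ φ : StrongDual 𝕜 E, (∀ y, ‖φ y‖ ≤ p y) → ‖φ (R n) - ∫ x in (0 : ℝ)..1, φ (w x)‖ ≤ ε := by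
    intro p hp ε hε
    have hU : {z : E × E | p (z.2 - z.1) < ε} ∈ uniformity E := by
      rw [uniformity_eq_comap_nhds_zero]
      refine preimage_mem_comap (m := fun x : E × E => x.2 - x.1) (t := {z | p z < ε}) ?_
      exact (hp.tendsto 0).eventually_lt_const (by simpa using hε)
    obtain ⟨δ, hδ, H⟩ := Metric.mem_uniformity_dist.1 (mem_inf_principal.1 (huc hU))
    obtain ⟨n0, hn0⟩ := exists_nat_one_div_lt hδ
    filter_upwards [eventually_ge_atTop (n0 + 1)] with n hn φ hφ
    have hpos : 0 < n := by omega
    have e : φ (R n) = ∑ j ∈ Finset.range n, ((1 / n : ℝ) : 𝕜) * φ (w (j / n)) := by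
      simp only [R, map_sum, map_smul, smul_eq_mul]
    rw [e]
    refine norm_riemannSum_sub_integral_le (φ.continuous.comp hw) hpos fun x hx y hy hxy => ?_
    rw [Function.comp, Function.comp, ← map_sub]
    refine (hφ _).trans (le_of_lt ?_)
    refine H (a := y) (b := x) ?_ ⟨hy, hx⟩
    rw [Real.dist_eq, abs_sub_comm]
    refine hxy.trans_lt (lt_of_le_of_lt ?_ hn0)
    have : ((n0 : ℝ) + 1) ≤ n := by exact_mod_cast hn
    gcongr
  have hC : Cauchy (map R atTop) := by
    rw [IsUniformAddGroup.cauchy_map_iff_tendsto]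
    refine ⟨inferInstance, (tendsto_iff_seminorm 𝕜).2 fun p hp ε hε => ?_⟩
    have h1 := key p hp (ε / 4) (by positivity)
    filter_upwards [h1.prod_mk h1] with x hx
    rw [sub_zero]
    obtain ⟨φ, hφ1, hφ2⟩ := exists_dual_eq_seminorm hp (R x.1 - R x.2)
    have h2 := hx.1 φ hφ2
    have h3 := hx.2 φ hφ2
    rw [← hφ1, map_sub]
    calc _ = ‖(φ (R x.1) - ∫ x in (0 : ℝ)..1, φ (w x))
          - (φ (R x.2) - ∫ x in (0 : ℝ)..1, φ (w x))‖ := by congr 1; ring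
      _ ≤ _ := norm_sub_le _ _
      _ < ε := by linarith
  obtain ⟨J, hJ⟩ := CompleteSpace.complete hC
  refine ⟨((a : ℝ) : 𝕜) • J, fun φ => ?_⟩
  have hlim : Tendsto (fun n => φ (R n)) atTop (𝓝 (∫ x in (0 : ℝ)..1, φ (w x))) := by
    refine Metric.tendsto_nhds.2 fun ε hε => ?_
    filter_upwards [key φ.toSeminorm φ.continuous.norm (ε / 2) (half_pos hε)] with n hn
    rw [dist_eq_norm]
    have := hn φ fun _ => le_rfl
    linarith
  have h1 := tendsto_nhds_unique ((φ.continuous.tendsto J).comp hJ) hlim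
  rw [map_smul, h1, smul_eq_mul, ← RCLike.real_smul_eq_coe_mul,
    intervalIntegral.smul_integral_comp_mul_left (fun r => φ (v r.toNNReal))]
  simp

omit [IsUniformAddGroup E] [ContinuousSMul 𝕜 E] [PolynormableSpace 𝕜 E] in
theorem IsWeakIntegral.dual_sub {v : ℝ≥0 → E} (hv : Continuous v) {a b : ℝ≥0} {I J : E}
    (hI : IsWeakIntegral 𝕜 v a I) (hJ : IsWeakIntegral 𝕜 v b J) (φ : StrongDual 𝕜 E) :
    φ (J - I) = ∫ r in (a : ℝ)..b, φ (v r.toNNReal) := by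
  have hc := continuous_dual_comp hv φ
  rw [map_sub, hI φ, hJ φ, intervalIntegral.integral_interval_sub_left
    (hc.intervalIntegrable _ _) (hc.intervalIntegrable _ _)]

omit [ContinuousSMul 𝕜 E] in
theorem IsWeakIntegral.eq_zero [T2Space E] {v : ℝ≥0 → E} {I : E} (hI : IsWeakIntegral 𝕜 v 0 I) :
    I = 0 :=
  eq_of_forall_dual_eq 𝕜 fun φ => by rw [hI φ]; simp

omit [IsUniformAddGroup E] [ContinuousSMul 𝕜 E] in
theorem hasRightDeriv_weakIntegral {v I : ℝ≥0 → E} (hv : Continuous v)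
    (hI : ∀ a, IsWeakIntegral 𝕜 v a (I a)) (r : ℝ≥0) : HasRightDeriv 𝕜 I (v r) r := by
  refine hasRightDeriv_iff.2 fun p hp ε hε => ?_
  have h1 : ∀ᶠ x in 𝓝 r, p (v x - v r) < ε :=
    (tendsto_iff_seminorm 𝕜).1 (hv.tendsto r) p hp ε hε
  obtain ⟨δ, hδ, H⟩ := Metric.eventually_nhds_iff.1 h1
  refine ⟨(δ / 2).toNNReal, by simpa using hδ, fun d hd => ?_⟩
  have hd' : (d : ℝ) ≤ δ / 2 := by
    have := NNReal.coe_le_coe.2 hd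
    rwa [Real.coe_toNNReal _ (by positivity)] at this
  obtain ⟨φ, h2, h3⟩ := exists_dual_eq_seminorm hp (I (r + d) - I r - ((d : ℝ) : 𝕜) • v r)
  rw [← h2, map_sub, (hI r).dual_sub hv (hI (r + d)), map_smul]
  have e : ((d : ℝ) : 𝕜) • φ (v r) = ∫ _x in (r : ℝ)..(r + d : ℝ≥0), φ (v r) := by
    rw [intervalIntegral.integral_const, RCLike.real_smul_eq_coe_mul]
    simp
  rw [e, ← intervalIntegral.integral_sub ((continuous_dual_comp hv φ).intervalIntegrable _ _)
    (by simp)]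
  refine (intervalIntegral.norm_integral_le_of_norm_le_const (C := ε) ?_).trans_eq ?_
  · intro x hx
    rw [Set.uIoc_of_le (by simp)] at hx
    have hx1 := hx.1
    have hx2 := hx.2
    push_cast at hx2
    rw [← map_sub]
    refine (h3 _).trans (H ?_).le
    rw [NNReal.dist_eq, Real.coe_toNNReal x (r.2.trans hx1.le), abs_of_nonneg (by linarith)]
    linarith
  · simp

omit [IsUniformAddGroup E] [ContinuousSMul 𝕜 E] in
theorem continuous_weakIntegral {v I : ℝ≥0 → E} (hv : Continuous v)
    (hI : ∀ a, IsWeakIntegral 𝕜 v a (I a)) : Continuous I := by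
  refine continuous_iff_continuousAt.2 fun r => (tendsto_iff_seminorm 𝕜).2 fun p hp ε hε => ?_
  have hbdd : BddAbove ((fun x => p (v x)) '' Set.Icc 0 (r + 1)) :=
    (isCompact_Icc.image (hp.comp hv)).bddAbove
  obtain ⟨C, hC⟩ := hbdd
  have hC' : ∀ x ≤ r + 1, p (v x) ≤ C := fun x hx => hC ⟨x, ⟨zero_le, hx⟩, rfl⟩
  have hC0 : 0 ≤ C := (apply_nonneg p (v 0)).trans (hC' 0 zero_le)
  have h1 : ∀ᶠ x in 𝓝 r, x < r + 1 := eventually_lt_nhds (lt_add_of_pos_right r one_pos)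
  have h2 : ∀ᶠ x : ℝ≥0 in 𝓝 r, C * |(x : ℝ) - r| < ε := by
    have : Continuous fun x : ℝ≥0 => C * |(x : ℝ) - r| := by fun_prop
    exact (this.tendsto r).eventually_lt_const (by simpa using hε)
  filter_upwards [h1, h2] with x hx1 hx2
  obtain ⟨φ, h3, h4⟩ := exists_dual_eq_seminorm hp (I x - I r)
  rw [← h3, (hI r).dual_sub hv (hI x)]
  refine (intervalIntegral.norm_integral_le_of_norm_le_const (C := C) ?_).trans_lt hx2
  intro y hy
  refine (h4 _).trans (hC' _ ?_)
  have hy2 := (Set.mem_uIoc.1 hy)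
  have hy3 : y ≤ (r + 1 : ℝ≥0) := by
    have : (x : ℝ) ≤ (r + 1 : ℝ≥0) := hx1.le
    push_cast at *
    rcases hy2 with h | h <;> linarith
  exact Real.toNNReal_le_iff_le_coe.2 hy3

end Integral

/-! ### Uniform boundedness on bounded sets -/

section UniformBoundedness

variable {𝕜 E : Type*} [RCLike 𝕜] [AddCommGroup E] [Module 𝕜 E] [UniformSpace E]
  [IsUniformAddGroup E] [ContinuousSMul 𝕜 E] [PolynormableSpace 𝕜 E]

omit [ContinuousSMul 𝕜 E] in
/-- In a complete locally convex space, `∑ cᵢ bᵢ` converges for `c ∈ ℓ¹` and bounded `b`. -/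
theorem exists_tendsto_sum_smul [CompleteSpace E] {c : ℕ → 𝕜} (hc : Summable fun i => ‖c i‖)
    {b : ℕ → E} (hb : Bornology.IsVonNBounded 𝕜 (Set.range b)) :
    ∃ x, Tendsto (fun n => ∑ i ∈ Finset.range n, c i • b i) atTop (𝓝 x) := by
  refine CompleteSpace.complete (f := map (fun n => ∑ i ∈ Finset.range n, c i • b i) atTop) ?_
  have hsc := hc.hasSum.tendsto_sum_nat.cauchySeq
  rw [IsUniformAddGroup.cauchy_map_iff_tendsto]
  refine ⟨inferInstance, (tendsto_iff_seminorm 𝕜).2 fun p hp ε hε => ?_⟩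
  obtain ⟨C, hC⟩ := isVonNBounded_iff_seminorm.1 hb p hp
  have hC' : ∀ i, p (b i) ≤ C := fun i => hC _ ⟨i, rfl⟩
  have hC0 : 0 ≤ C := (apply_nonneg p (b 0)).trans (hC' 0)
  have hle : ∀ m n, m ≤ n → p (∑ i ∈ Finset.range n, c i • b i - ∑ i ∈ Finset.range m, c i • b i)
      ≤ C * dist (∑ i ∈ Finset.range n, ‖c i‖) (∑ i ∈ Finset.range m, ‖c i‖) := by
    intro m n hmn
    rw [← Finset.sum_Ico_eq_sub _ hmn, Real.dist_eq, ← Finset.sum_Ico_eq_sub _ hmn,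
      abs_of_nonneg (Finset.sum_nonneg fun _ _ => norm_nonneg _), Finset.mul_sum]
    refine (Finset.le_sum_of_subadditive p (map_zero p).le (map_add_le_add p) _ _).trans ?_
    refine Finset.sum_le_sum fun i _ => ?_
    rw [map_smul_eq_mul, mul_comm]
    exact mul_le_mul_of_nonneg_right (hC' i) (norm_nonneg _)
  obtain ⟨N, hN⟩ := Metric.cauchySeq_iff.1 hsc (ε / (C + 1)) (by positivity)
  filter_upwards [(eventually_ge_atTop N).prod_mk (eventually_ge_atTop N)] with x hx
  rw [sub_zero]
  have h1 : p (∑ i ∈ Finset.range x.1, c i • b i - ∑ i ∈ Finset.range x.2, c i • b i)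
      ≤ C * dist (∑ i ∈ Finset.range x.1, ‖c i‖) (∑ i ∈ Finset.range x.2, ‖c i‖) := by
    rcases le_total x.1 x.2 with h | h
    · rw [map_sub_rev, dist_comm]; exact hle _ _ h
    · exact hle _ _ h
  refine h1.trans_lt ?_
  calc C * _ ≤ C * (ε / (C + 1)) := by
        gcongr; exact (hN _ hx.1 _ hx.2).le
    _ < (C + 1) * (ε / (C + 1)) := by gcongr; linarith
    _ = ε := by field_simp

omit [ContinuousSMul 𝕜 E] in
/-- **Uniform boundedness on bounded sets**: in a complete locally convex space, a pointwise bounded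
family of continuous functionals is uniformly bounded on every bounded set. (The space is not
assumed to be barrelled; Banach-Steinhaus is applied on `ℓ¹`, mapped into `E` by
`c ↦ ∑ cᵢ bᵢ`.) -/
theorem exists_bound_of_pointwise_bounded [CompleteSpace E] {ι : Type*} {ψ : ι → StrongDual 𝕜 E}
    (hψ : ∀ x, ∃ C, ∀ k, ‖ψ k x‖ ≤ C) {B : Set E} (hB : Bornology.IsVonNBounded 𝕜 B) :
    ∃ M, ∀ k, ∀ b ∈ B, ‖ψ k b‖ ≤ M := by
  by_contra! hcon
  choose k b hbB hkb using fun n : ℕ => hcon n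
  -- The functionals `L j : c ↦ ∑ cᵢ ψⱼ(bᵢ)` on `ℓ¹` are pointwise bounded, but not uniformly:
  -- `‖ψ (k n) (b n)‖ > n`.
  have hb : Bornology.IsVonNBounded 𝕜 (Set.range b) := hB.subset (Set.range_subset_iff.2 hbB)
  have hsum : ∀ c : lp (fun _ : ℕ => 𝕜) 1, Summable fun i => ‖c i‖ := fun c => by
    have := (lp.memℓp c).summable (by simp)
    simpa using this
  have hnorm : ∀ c : lp (fun _ : ℕ => 𝕜) 1, ∑' i, ‖c i‖ = ‖c‖ := fun c => by
    rw [lp.norm_eq_tsum_rpow (by simp)]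
    simp
  have hbd : ∀ j, ∃ C, ∀ i, ‖ψ j (b i)‖ ≤ C := fun j => by
    obtain ⟨C, hC⟩ := isVonNBounded_iff_seminorm.1 hb (ψ j).toSeminorm (ψ j).continuous.norm
    exact ⟨C, fun i => hC _ ⟨i, rfl⟩⟩
  have hsum2 : ∀ (c : lp (fun _ : ℕ => 𝕜) 1) j, Summable fun i => c i * ψ j (b i) := fun c j => by
    obtain ⟨C, hC⟩ := hbd j
    refine Summable.of_norm_bounded ((hsum c).mul_right C) fun i => ?_
    rw [norm_mul]
    exact mul_le_mul_of_nonneg_left (hC i) (norm_nonneg _)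
  choose C hC using hbd
  let L : ι → lp (fun _ : ℕ => 𝕜) 1 →L[𝕜] 𝕜 := fun j =>
    LinearMap.mkContinuous
      { toFun := fun c => ∑' i, c i * ψ j (b i)
        map_add' := fun c d => by
          rw [← (hsum2 c j).tsum_add (hsum2 d j)]
          exact tsum_congr fun i => by simp [add_mul]
        map_smul' := fun a c => by
          rw [RingHom.id_apply, smul_eq_mul, ← tsum_mul_left]
          exact tsum_congr fun i => by simp [mul_assoc] } (C j) (fun c => by
        have h1 : ∀ i, ‖c i * ψ j (b i)‖ ≤ C j * ‖c i‖ := fun i => by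
          rw [norm_mul, mul_comm]
          exact mul_le_mul_of_nonneg_right (hC j i) (norm_nonneg _)
        have := tsum_of_norm_bounded ((hsum c).mul_left (C j)).hasSum h1
        rwa [tsum_mul_left, hnorm] at this)
  have hL : ∀ j c, L j c = ∑' i, c i * ψ j (b i) := fun j c => rfl
  obtain ⟨M, hM⟩ := banach_steinhaus (g := L) fun c => by
    obtain ⟨x, hx⟩ := exists_tendsto_sum_smul (hsum c) hb
    obtain ⟨K, hK⟩ := hψ x
    refine ⟨K, fun j => ?_⟩
    have h1 : Tendsto (fun n => ∑ i ∈ Finset.range n, c i * ψ j (b i)) atTop (𝓝 (ψ j x)) := by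
      have := ((ψ j).continuous.tendsto x).comp hx
      simpa [Function.comp_def] using this
    rw [hL, tendsto_nhds_unique (hsum2 c j).hasSum.tendsto_sum_nat h1]
    exact hK j
  obtain ⟨n, hn⟩ := exists_nat_ge M
  have h1 := (L (k n)).le_of_opNorm_le (hM (k n)) (lp.single 1 n (1 : 𝕜))
  rw [hL, lp.norm_single (by simp), tsum_eq_single n (fun i hi => by simp [hi])] at h1
  simp at h1
  linarith [hkb n]

end UniformBoundedness

/-! ### Diagonal extraction of subsequences -/

section Diagonal

/-- Diagonal extraction: countably many properties of subsequences, each of which can be achieved by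
passing to a further subsequence, can be achieved simultaneously. -/
theorem exists_strictMono_forall {P : ℕ → Filter ℕ → Prop}
    (hanti : ∀ k l l', l' ≤ l → P k l → P k l')
    (h : ∀ k (σ : ℕ → ℕ), StrictMono σ → ∃ θ : ℕ → ℕ, StrictMono θ ∧ P k (map (σ ∘ θ) atTop)) :
    ∃ σ : ℕ → ℕ, StrictMono σ ∧ ∀ k, P k (map σ atTop) := by
  choose θ hθ hP using h
  let seq : ℕ → {σ : ℕ → ℕ // StrictMono σ} := fun n =>
    Nat.rec ⟨id, strictMono_id⟩ (fun k σ => ⟨σ.1 ∘ θ k σ.1 σ.2, σ.2.comp (hθ k σ.1 σ.2)⟩) n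
  let l : ℕ → Filter ℕ := fun k => map (seq k).1 atTop
  have hl : Antitone l := antitone_nat_of_succ_le fun k => by
    change map ((seq k).1 ∘ θ k (seq k).1 (seq k).2) atTop ≤ map (seq k).1 atTop
    rw [← map_map]
    exact map_mono (hθ k _ _).tendsto_atTop
  have hlP : ∀ k, P k (l (k + 1)) := fun k => hP k (seq k).1 (seq k).2
  have hne : NeBot (⨅ k, l k) := iInf_neBot_of_directed hl.directed_ge fun k => inferInstance
  obtain ⟨u, hu⟩ := (⨅ k, l k).exists_seq_tendsto
  have hu0 : Tendsto u atTop atTop := hu.mono_right <| (iInf_le l 0).trans (by simp [l, seq])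
  obtain ⟨τ, hτ, huτ⟩ := strictMono_subseq_of_tendsto_atTop hu0
  refine ⟨u ∘ τ, huτ, fun k => hanti k _ _ ?_ (hlP k)⟩
  exact (hu.comp hτ.tendsto_atTop).trans (iInf_le l (k + 1))

end Diagonal

/-! ### Weak limits of the step evolutions -/

section WeakLimits

variable {𝕜 E : Type*} [RCLike 𝕜] [AddCommGroup E] [Module 𝕜 E] [UniformSpace E]
  [IsUniformAddGroup E] [ContinuousSMul 𝕜 E] [PolynormableSpace 𝕜 E]

theorem tendsto_div_nat {t : ℝ≥0} (ht : 0 < t) {σ : ℕ → ℕ} (hσ : StrictMono σ) :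
    Tendsto (fun k => t / σ k) atTop (𝓝[>] (0 : ℝ≥0)) := by
  refine tendsto_nhdsWithin_iff.2 ⟨?_, ?_⟩
  · exact (tendsto_const_div_atTop_nhds_zero_nat t).comp hσ.tendsto_atTop
  · filter_upwards [hσ.tendsto_atTop.eventually_gt_atTop 0] with k hk
    have : (0 : ℝ≥0) < σ k := by exact_mod_cast hk
    exact div_pos ht this

theorem natCast_mul_div (n : ℕ) (s t : ℝ≥0) : n * s / t = s / (t / n) := by
  rw [div_div_eq_mul_div, mul_comm]

/-- Membership in a closed linear relation is detected by pairs of functionals. -/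
theorem mem_of_forall_pair_eq_zero {S : Submodule 𝕜 (E × E)} (hS : IsClosed (S : Set (E × E)))
    {x y : E}
    (h : ∀ φ ψ : StrongDual 𝕜 E, (∀ w ∈ S, φ w.1 + ψ w.2 = 0) → φ x + ψ y = 0) : (x, y) ∈ S := by
  refine mem_of_forall_dual_eq_zero hS fun Φ hΦ => ?_
  have e : ∀ a b, Φ (a, b) = Φ.comp (ContinuousLinearMap.inl 𝕜 E E) a
      + Φ.comp (ContinuousLinearMap.inr 𝕜 E E) b := by
    intro a b
    simp [← map_add]
  rw [e]
  refine h _ _ fun w hw => ?_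
  rw [← e]
  exact hΦ w hw

/-- Closed linear relations are weakly sequentially closed. -/
theorem mem_of_weakLim {S : Submodule 𝕜 (E × E)} (hS : IsClosed (S : Set (E × E)))
    {w : ℕ → E × E} (hw : ∀ n, w n ∈ S) {x y : E} (hx : WeakLim 𝕜 (fun n => (w n).1) x)
    (hy : WeakLim 𝕜 (fun n => (w n).2) y) : (x, y) ∈ S := by
  refine mem_of_forall_pair_eq_zero hS fun φ ψ h => ?_
  refine tendsto_nhds_unique ((hx φ).add (hy ψ)) ?_
  simp only [h _ (hw _), tendsto_const_nhds]

/-- Under the approximation condition, the step evolutions have, along subsequences, weak limits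
in the domain of the closed operator. -/
theorem exists_weakLim_mem_domain {Z : E →ₗ.[𝕜] E} (hZ : Z.IsClosed) {w : ℕ → E} {a : ℕ → Z.domain}
    (h1 : WeakLim 𝕜 (fun n => w n - (a n : E)) 0) (h2 : WeakSeqRelCompact 𝕜 (fun n => Z (a n)))
    (h3 : WeakSeqRelCompact 𝕜 (fun n => (a n : E))) {σ : ℕ → ℕ} (hσ : StrictMono σ) :
    ∃ θ : ℕ → ℕ, StrictMono θ ∧ ∃ x ∈ Z.domain, WeakLim 𝕜 (fun k => w (σ (θ k))) x := by
  obtain ⟨θ, hθ, x, hx⟩ := h3 σ hσ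
  obtain ⟨τ, hτ, y, hy⟩ := h2 (σ ∘ θ) (hσ.comp hθ)
  refine ⟨θ ∘ τ, hθ.comp hτ, x, ?_, fun φ => ?_⟩
  · have hx' : WeakLim 𝕜 (fun k => (a (σ (θ (τ k))) : E)) x := fun φ =>
      (hx φ).comp hτ.tendsto_atTop
    exact LinearPMap.mem_domain_of_mem_graph
      (mem_of_weakLim hZ (w := fun k => ((a (σ (θ (τ k))) : E), Z (a (σ (θ (τ k))))))
        (fun k => Z.mem_graph _) hx' hy)
  · have e1 := (h1 φ).comp ((hσ.comp (hθ.comp hτ)).tendsto_atTop)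
    have e2 := ((hx φ).comp hτ.tendsto_atTop).add e1
    simpa [Function.comp_def] using e2

/-- A common subsequence along which the step evolutions of `f` converge weakly at all times. -/
theorem MemF.exists_weakLim_step {F : ℝ≥0 → E →L[𝕜] E} (hF : MemF F) {t : ℝ≥0} (ht : 0 < t)
    (f : E) {D : Set E}
    (H : ∀ (s : ℝ≥0) (σ : ℕ → ℕ), StrictMono σ → ∃ θ : ℕ → ℕ, StrictMono θ ∧ ∃ x ∈ D,
      WeakLim 𝕜 (fun k => (F (t / (σ (θ k) : ℕ)) ^ ⌊s / (t / (σ (θ k) : ℕ))⌋₊) f) x) :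
    ∃ σ : ℕ → ℕ, StrictMono σ ∧ ∃ v : ℝ≥0 → E, (∀ s, v s ∈ D) ∧
      ∀ s, WeakLim 𝕜 (fun k => (F (t / (σ k : ℕ)) ^ ⌊s / (t / (σ k : ℕ))⌋₊) f) (v s) := by
  let S : ℕ → ℝ≥0 → E := fun n s => (F (t / n) ^ ⌊s / (t / n)⌋₊) f
  obtain ⟨σ, hσ, hc⟩ := exists_strictMono_forall
    (P := fun k l => ∃ x, ∀ φ : StrongDual 𝕜 E,
      Tendsto (fun n => φ (S n (TopologicalSpace.denseSeq ℝ≥0 k))) l (𝓝 (φ x)))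
    (fun k l l' hl ⟨x, hx⟩ => ⟨x, fun φ => (hx φ).mono_left hl⟩)
    (fun k σ hσ => by
      obtain ⟨θ, hθ, x, -, hx⟩ := H (TopologicalSpace.denseSeq ℝ≥0 k) σ hσ
      exact ⟨θ, hθ, x, fun φ => hx φ⟩)
  have hall : ∀ s, ∃ x ∈ D, WeakLim 𝕜 (fun k => S (σ k) s) x := by
    intro s
    obtain ⟨θ, hθ, x, hxD, hx⟩ := H s σ hσ
    refine ⟨x, hxD, fun φ => ?_⟩
    refine tendsto_nhds_of_cauchySeq_of_subseq ?_ hθ.tendsto_atTop (hx φ)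
    refine Metric.cauchySeq_iff.2 fun ε hε => ?_
    obtain ⟨δ, hδ, hd⟩ := hF.exists_step_sub_le f s (p := φ.toSeminorm) φ.continuous.norm
      (show 0 < ε / 4 by positivity)
    obtain ⟨j, hr1, hr2⟩ := (TopologicalSpace.denseRange_denseSeq ℝ≥0).exists_mem_open
      isOpen_Ioo (Set.nonempty_Ioo.2 (lt_add_of_pos_right s hδ))
    obtain ⟨y, hy⟩ := hc j
    have h1 := (tendsto_div_nat ht hσ).eventually (hd s _ le_rfl hr1.le hr2.le)
    obtain ⟨N1, hN1⟩ := eventually_atTop.1 h1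
    obtain ⟨N2, hN2⟩ := Metric.cauchySeq_iff.1 (tendsto_map'_iff.1 (hy φ)).cauchySeq (ε / 4)
      (by positivity)
    refine ⟨max N1 N2, fun m hm n hn => ?_⟩
    have a1 : dist (φ (S (σ m) (TopologicalSpace.denseSeq ℝ≥0 j))) (φ (S (σ m) s)) ≤ ε / 4 := by
      rw [dist_eq_norm, ← map_sub]
      exact hN1 m ((le_max_left _ _).trans hm)
    have a2 : dist (φ (S (σ n) (TopologicalSpace.denseSeq ℝ≥0 j))) (φ (S (σ n) s)) ≤ ε / 4 := by
      rw [dist_eq_norm, ← map_sub]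
      exact hN1 n ((le_max_left _ _).trans hn)
    have a3 : dist (φ (S (σ m) (TopologicalSpace.denseSeq ℝ≥0 j)))
        (φ (S (σ n) (TopologicalSpace.denseSeq ℝ≥0 j))) < ε / 4 :=
      hN2 m ((le_max_right _ _).trans hm) n ((le_max_right _ _).trans hn)
    rw [dist_comm] at a1
    have a4 := dist_triangle4 (φ (S (σ m) s)) (φ (S (σ m) (TopologicalSpace.denseSeq ℝ≥0 j)))
      (φ (S (σ n) (TopologicalSpace.denseSeq ℝ≥0 j))) (φ (S (σ n) s))
    change dist (φ (S (σ m) s)) (φ (S (σ n) s)) < ε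
    linarith
  choose v hvD hv using hall
  exact ⟨σ, hσ, v, hvD, hv⟩

theorem MemF.continuous_of_weakLim_step {F : ℝ≥0 → E →L[𝕜] E} (hF : MemF F) {f : E}
    {h : ℕ → ℝ≥0} (hh : Tendsto h atTop (𝓝[>] 0)) {v : ℝ≥0 → E}
    (hv : ∀ s, WeakLim 𝕜 (fun k => (F (h k) ^ ⌊s / h k⌋₊) f) (v s)) : Continuous v := by
  refine continuous_iff_continuousAt.2 fun r => (tendsto_iff_seminorm 𝕜).2 fun p hp ε hε => ?_
  obtain ⟨δ, hδ, hd⟩ := hF.exists_step_sub_le f (r + 1) hp (half_pos hε)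
  have key : ∀ a b, a ≤ r + 1 → a ≤ b → b ≤ a + δ → p (v b - v a) < ε := by
    intro a b ha hab hb
    obtain ⟨φ, h1, h2⟩ := exists_dual_eq_seminorm hp (v b - v a)
    refine lt_of_le_of_lt ?_ (half_lt_self hε)
    rw [← h1, map_sub]
    refine le_of_tendsto ((hv b φ).sub (hv a φ)).norm ?_
    filter_upwards [hh.eventually (hd a b ha hab hb)] with k hk
    rw [← map_sub]
    exact (h2 _).trans hk
  have h1 : ∀ᶠ x in 𝓝 r, x < r + 1 := eventually_lt_nhds (lt_add_of_pos_right r one_pos)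
  have h2 : ∀ᶠ x in 𝓝 r, x < r + δ := eventually_lt_nhds (lt_add_of_pos_right r hδ)
  have h3 : ∀ᶠ x in 𝓝 r, r < x + δ :=
    (continuous_id.add continuous_const).tendsto r |>.eventually_const_lt
      (lt_add_of_pos_right r hδ)
  filter_upwards [h1, h2, h3] with x h1 h2 h3
  rcases le_total r x with hrx | hrx
  · exact key r x (le_add_of_nonneg_right zero_le_one) hrx h2.le
  · rw [map_sub_rev]
    exact key x r h1.le hrx h3.le

end WeakLimits

/-! ### Duality with the derivative of the adjoint -/

section Adjoint

variable {𝕜 E : Type*} [RCLike 𝕜] [AddCommGroup E] [Module 𝕜 E] [UniformSpace E]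
  [IsUniformAddGroup E] [ContinuousSMul 𝕜 E] [PolynormableSpace 𝕜 E]

omit [IsUniformAddGroup E] [ContinuousSMul 𝕜 E] [PolynormableSpace 𝕜 E] in
theorem diffQuot_adjointFun_apply (F : ℝ≥0 → E →L[𝕜] E) (h : ℝ≥0) (ψ : StrongDual 𝕜 E) (x : E) :
    diffQuot (adjointFun F) h ψ x = ψ (diffQuot F h x) := by
  simp [diffQuot, adjointFun]

omit [IsUniformAddGroup E] [ContinuousSMul 𝕜 E] [PolynormableSpace 𝕜 E] in
theorem eventually_norm_dual_diffQuot_sub_le {F : ℝ≥0 → E →L[𝕜] E} {ψ ψ' : StrongDual 𝕜 E}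
    (hψ : (ψ, ψ') ∈ derivGraph (adjointFun F)) {B : Set E} (hB : Bornology.IsVonNBounded 𝕜 B)
    {ε : ℝ} (hε : 0 < ε) :
    ∀ᶠ h in 𝓝[>] (0 : ℝ≥0), ∀ x ∈ B, ‖ψ (diffQuot F h x) - ψ' x‖ ≤ ε := by
  have h1 : Tendsto (fun h => diffQuot (adjointFun F) h ψ - ψ') (𝓝[>] 0) (𝓝 0) := by
    have h2 : Tendsto (fun h => diffQuot (adjointFun F) h ψ) (𝓝[>] 0) (𝓝 ψ') := hψ
    simpa using h2.sub_const ψ'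
  filter_upwards [h1.eventually (ContinuousLinearMap.eventually_nhds_zero_mapsTo hB
    (Metric.closedBall_mem_nhds (0 : 𝕜) hε))] with h hh x hx
  have := hh hx
  rwa [mem_closedBall_zero_iff, sub_apply, diffQuot_adjointFun_apply] at this

omit [PolynormableSpace 𝕜 E] in
/-- Duality between the derivative of the adjoint and the effective derivative. -/
theorem dual_eq_of_mem_closure {F : ℝ≥0 → E →L[𝕜] E} {ψ ψ' : StrongDual 𝕜 E}
    (hψ : (ψ, ψ') ∈ derivGraph (adjointFun F)) {x y : E}
    (hxy : (x, y) ∈ (mefGraph F).topologicalClosure) : ψ' x = ψ y := by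
  have hcl : IsClosed {w : E × E | ψ' w.1 = ψ w.2} :=
    isClosed_eq (by fun_prop) (by fun_prop)
  refine hcl.closure_subset_iff.2 ?_ hxy
  rintro ⟨x, y⟩ ⟨u, hu, hu'⟩
  -- The convergence `u(h) → x` is used along a sequence, whose range is bounded.
  have hh : Tendsto (fun k : ℕ => (1 : ℝ≥0) / (k : ℕ)) atTop (𝓝[>] 0) :=
    tendsto_div_nat one_pos strictMono_id
  have h1 := hu.comp hh
  have h2 := hu'.comp hh
  have h3 : Tendsto (fun k : ℕ => ψ (diffQuot F (1 / (k : ℕ)) (u (1 / (k : ℕ))))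
      - ψ' (u (1 / (k : ℕ)))) atTop (𝓝 0) := by
    refine Metric.tendsto_nhds.2 fun ε hε => ?_
    filter_upwards [hh.eventually (eventually_norm_dual_diffQuot_sub_le hψ
      (h1.isVonNBounded_range 𝕜) (half_pos hε))] with k hk
    rw [dist_zero_right]
    have := hk _ ⟨k, rfl⟩
    simp only [Function.comp] at this
    linarith
  have h4 := ((ψ.continuous.tendsto y).comp h2).sub ((ψ'.continuous.tendsto x).comp h1)
  exact (sub_eq_zero.1 (tendsto_nhds_unique h4 h3)).symm

/-- The powers `F(h)^m` with `m h ≤ s` map a bounded set into a bounded set. -/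
theorem MemE.isVonNBounded_pow {F : ℝ≥0 → E →L[𝕜] E} (hF : MemE F) (s : ℝ≥0) {B : Set E}
    (hB : Bornology.IsVonNBounded 𝕜 B) :
    Bornology.IsVonNBounded 𝕜 {z | ∃ (h : ℝ≥0) (m : ℕ), m * h ≤ s ∧ ∃ b ∈ B, (F h ^ m) b = z} := by
  refine isVonNBounded_iff_seminorm.2 fun p hp => ?_
  obtain ⟨q, hq, hb⟩ := hF.exists_bound s hp
  obtain ⟨C, hC⟩ := isVonNBounded_iff_seminorm.1 hB q hq
  refine ⟨C, ?_⟩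
  rintro _ ⟨h, m, hm, b, hbB, rfl⟩
  exact (hb h m hm b).trans (hC b hbB)

omit [ContinuousSMul 𝕜 E] [PolynormableSpace 𝕜 E] in
theorem diffQuot_pow_comm {F : ℝ≥0 → E →L[𝕜] E} (hF : MemE F) (h : ℝ≥0) (m : ℕ) (x : E) :
    diffQuot F h ((F h ^ m) x) = (F h ^ m) (diffQuot F h x) := by
  have e : F h ((F h ^ m) x) = (F h ^ m) (F h x) := by
    rw [← mul_apply_eq_comp, ← mul_apply_eq_comp, ← pow_succ, ← pow_succ']
  simp only [diffQuot, hF.map_zero, map_smul, map_sub, e]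
  rfl

/-- The weak limit `v` of the step evolutions satisfies `(ψ ∘ v)' = ψ' ∘ v` for `ψ` in the domain of
the derivative `ψ ↦ ψ'` of the adjoint. -/
theorem MemF.hasRightDeriv_dual_weakLim {F : ℝ≥0 → E →L[𝕜] E} (hF : MemF F) {f : E}
    {h : ℕ → ℝ≥0} (hh : Tendsto h atTop (𝓝[>] 0)) {v : ℝ≥0 → E}
    (hv : ∀ s, WeakLim 𝕜 (fun k => (F (h k) ^ ⌊s / h k⌋₊) f) (v s)) {ψ ψ' : StrongDual 𝕜 E}
    (hψ : (ψ, ψ') ∈ derivGraph (adjointFun F)) (r : ℝ≥0) :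
    HasRightDeriv 𝕜 (fun s => ψ (v s)) (ψ' (v r)) r := by
  suffices H : ∀ ε > 0, ∃ δ > (0 : ℝ≥0), ∀ d ≤ δ,
      ‖ψ (v (r + d)) - ψ (v r) - ((d : ℝ) : 𝕜) • ψ' (v r)‖ ≤ ε * d by
    refine hasRightDeriv_iff.2 fun p hp ε hε => ?_
    obtain ⟨C, hC, hpC⟩ := p.bound_of_continuous_normedSpace hp
    obtain ⟨δ, hδ, hd⟩ := H (ε / C) (by positivity)
    refine ⟨δ, hδ, fun d hdδ => (hpC _).trans ?_⟩
    calc C * _ ≤ C * (ε / C * d) := by gcongr; exact hd d hdδ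
      _ = ε * d := by field_simp
  intro ε hε
  obtain ⟨q, hq, hb⟩ := hF.exists_bound r (p := ψ'.toSeminorm) ψ'.continuous.norm
  obtain ⟨δ1, hδ1, h1⟩ := hF.exists_pow_sub_le f hq (half_pos hε)
  have hB := hF.isVonNBounded_pow (r + 1) (Bornology.isVonNBounded_singleton (𝕜 := 𝕜) f)
  have h2 := eventually_norm_dual_diffQuot_sub_le hψ hB (half_pos hε)
  have hδ2 : 0 < δ1 / 2 := by positivity
  refine ⟨min 1 (δ1 / 2), lt_min one_pos hδ2, fun d hd => ?_⟩
  rw [le_min_iff] at hd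
  have hrd : r ≤ r + d := le_add_of_nonneg_right d.2
  obtain ⟨μ, hμ⟩ : ∃ μ : ℕ → ℕ, ∀ k, μ k = ⌊(r + d) / h k⌋₊ - ⌊r / h k⌋₊ := ⟨_, fun _ => rfl⟩
  let κ : ℕ → ℝ≥0 := fun k => μ k * h k
  have hh0 : Tendsto (fun k => (h k : ℝ)) atTop (𝓝 0) := tendsto_coe_nhdsGT_zero.comp hh
  have hpos : ∀ᶠ k in atTop, 0 < h k := hh.eventually self_mem_nhdsWithin
  have hκ : Tendsto (fun k => (κ k : ℝ)) atTop (𝓝 d) := by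
    rw [tendsto_iff_dist_tendsto_zero]
    refine squeeze_zero' (Eventually.of_forall fun _ => dist_nonneg) ?_ hh0
    filter_upwards [hpos] with k hk
    rw [Real.dist_eq]
    have := abs_natFloor_sub_mul_sub_le (r := r) (d := d) hk
    rw [← hμ] at this
    simpa [κ] using this
  have hlim1 : Tendsto (fun k => ‖ψ ((F (h k) ^ ⌊(r + d) / h k⌋₊) f)
      - ψ ((F (h k) ^ ⌊r / h k⌋₊) f)
      - ((κ k : ℝ) : 𝕜) • ψ' ((F (h k) ^ ⌊r / h k⌋₊) f)‖) atTop
      (𝓝 ‖ψ (v (r + d)) - ψ (v r) - ((d : ℝ) : 𝕜) • ψ' (v r)‖) :=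
    (((hv (r + d) ψ).sub (hv r ψ)).sub
      ((((RCLike.continuous_ofReal (K := 𝕜)).tendsto _).comp hκ).smul (hv r ψ'))).norm
  have hlim2 : Tendsto (fun k => ε * (κ k : ℝ)) atTop (𝓝 (ε * d)) := hκ.const_mul ε
  refine le_of_tendsto_of_tendsto hlim1 hlim2 ?_
  filter_upwards [hh.eventually h1, hh.eventually h2, hpos,
    hh.eventually (Ioc_mem_nhdsGT hδ2)] with k h1 h2 h0 h3
  set z := (F (h k) ^ ⌊r / h k⌋₊) f with hz
  have hm' : ⌊(r + d) / h k⌋₊ = μ k + ⌊r / h k⌋₊ := by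
    rw [hμ, Nat.sub_add_cancel (natFloor_div_mono (h k) hrd)]
  have hmδ : μ k * h k ≤ δ1 := by
    have := natFloor_sub_mul_le_add h0 hrd
    rw [add_tsub_cancel_left, ← hμ] at this
    exact this.trans ((add_le_add hd.2 h3.2).trans_eq (add_halves δ1))
  have e : ψ ((F (h k) ^ ⌊(r + d) / h k⌋₊) f) - ψ z - ((κ k : ℝ) : 𝕜) • ψ' z
      = ∑ j ∈ Finset.range (μ k), (((h k : ℝ≥0) : ℝ) : 𝕜) •
        (ψ (diffQuot F (h k) ((F (h k) ^ j) z)) - ψ' z) := by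
    rw [hm', pow_add, mul_apply_eq_comp, ← hz, ← map_sub, hF.pow_sub_eq_sum_diffQuot h0, map_sum]
    simp only [smul_sub, Finset.sum_sub_distrib, map_smul, diffQuot_pow_comm hF.toMemE,
      Finset.sum_const, Finset.card_range, κ]
    congr 1
    rw [← Nat.cast_smul_eq_nsmul 𝕜, smul_smul]
    push_cast
    rfl
  rw [e]
  have h4 := seminorm_sum_le (normSeminorm 𝕜 𝕜) (h k) (μ k)
    (fun j => ψ (diffQuot F (h k) ((F (h k) ^ j) z)) - ψ' z) (C := ε) (fun j hj => ?_)
  · refine h4.trans_eq ?_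
    simp [κ, mul_comm]
  · have hjN : (F (h k) ^ j) z = (F (h k) ^ (j + ⌊r / h k⌋₊)) f := by
      rw [pow_add, mul_apply_eq_comp]
    have h5 := h2 ((F (h k) ^ j) z) ⟨h k, j + ⌊r / h k⌋₊,
      (natCast_mul_le_of_le (by omega) (natFloor_mul_le h0)).trans (add_le_add_right hd.1 r), f, rfl,
      hjN.symm⟩
    have h6 : ‖ψ' ((F (h k) ^ j) z) - ψ' z‖ ≤ ε / 2 := by
      have e2 : (F (h k) ^ j) z - z = (F (h k) ^ ⌊r / h k⌋₊) ((F (h k) ^ j) f - f) := by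
        rw [map_sub, hz, ← mul_apply_eq_comp, ← mul_apply_eq_comp, pow_mul_comm]
      rw [← map_sub, e2]
      exact (hb (h k) _ (natFloor_mul_le h0) _).trans (h1 j (natCast_mul_le_of_le hj.le hmδ))
    calc ‖ψ (diffQuot F (h k) ((F (h k) ^ j) z)) - ψ' z‖
        = ‖(ψ (diffQuot F (h k) ((F (h k) ^ j) z)) - ψ' ((F (h k) ^ j) z))
          + (ψ' ((F (h k) ^ j) z) - ψ' z)‖ := by congr 1; ring
      _ ≤ _ := norm_add_le _ _
      _ ≤ ε := by linarith

/-- A bounded set `B` such that `|ψ'(v(r))| ≤ sup_B |ψ|` for all `r ≤ s` and all `ψ` in the domain of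
the derivative `ψ ↦ ψ'` of the adjoint. It consists of the vectors `F(h)^m (h⁻¹ (F(h) - F(0)) u(h))`,
where `u(h) → f` realizes the effective derivative at `f`. -/
theorem MemF.exists_bounded_forall_dual_le {F : ℝ≥0 → E →L[𝕜] E} (hF : MemF F) {f g : E}
    (hfg : (f, g) ∈ mefGraph F) {h : ℕ → ℝ≥0} (hh : Tendsto h atTop (𝓝[>] 0)) {v : ℝ≥0 → E}
    (hv : ∀ s, WeakLim 𝕜 (fun k => (F (h k) ^ ⌊s / h k⌋₊) f) (v s)) (s : ℝ≥0) :
    ∃ B : Set E, Bornology.IsVonNBounded 𝕜 B ∧ ∀ ψ ψ' : StrongDual 𝕜 E,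
      (ψ, ψ') ∈ derivGraph (adjointFun F) → ∀ M, (∀ b ∈ B, ‖ψ b‖ ≤ M) →
        ∀ r ≤ s, ‖ψ' (v r)‖ ≤ M := by
  obtain ⟨u, hu, hu'⟩ := hfg
  have hu2 := hu.comp hh
  have hu2' := hu'.comp hh
  refine ⟨_, hF.isVonNBounded_pow s (hu2'.isVonNBounded_range 𝕜), fun ψ ψ' hψ M hM r hr => ?_⟩
  refine le_of_forall_pos_le_add fun ε hε => ?_
  refine le_of_tendsto (hv r ψ').norm ?_
  obtain ⟨q, hq, hb⟩ := hF.exists_bound s (p := ψ'.toSeminorm) ψ'.continuous.norm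
  have h2 := eventually_norm_dual_diffQuot_sub_le hψ
    (hF.isVonNBounded_pow s (hu2.isVonNBounded_range 𝕜)) (half_pos hε)
  filter_upwards [hh.eventually h2, hh.eventually self_mem_nhdsWithin,
    (tendsto_iff_seminorm 𝕜).1 hu2 q hq (ε / 2) (half_pos hε)] with k h2 h0 h3
  have hN : (⌊r / h k⌋₊ : ℝ≥0) * h k ≤ s := (natFloor_mul_le h0).trans hr
  have h4 := h2 _ ⟨h k, ⌊r / h k⌋₊, hN, _, ⟨k, rfl⟩, rfl⟩
  rw [diffQuot_pow_comm hF.toMemE] at h4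
  have h5 := hM _ ⟨h k, ⌊r / h k⌋₊, hN, _, ⟨k, rfl⟩, rfl⟩
  have h6 := hb (h k) ⌊r / h k⌋₊ hN (u (h k) - f)
  rw [map_sub] at h6
  simp only [Function.comp] at h3 h4 h5
  set a := (F (h k) ^ ⌊r / h k⌋₊) f
  set b := (F (h k) ^ ⌊r / h k⌋₊) (u (h k))
  set c := (F (h k) ^ ⌊r / h k⌋₊) (diffQuot F (h k) (u (h k)))
  have h7 : ‖ψ' (b - a)‖ ≤ q (u (h k) - f) := h6
  rw [map_sub] at h7
  calc ‖ψ' a‖ = ‖ψ c - (ψ c - ψ' b) - (ψ' b - ψ' a)‖ := by congr 1; ring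
    _ ≤ ‖ψ c‖ + ‖ψ c - ψ' b‖ + ‖ψ' b - ψ' a‖ :=
      (norm_sub_le _ _).trans (add_le_add (norm_sub_le _ _) le_rfl)
    _ ≤ M + ε := by linarith

/-- Fundamental theorem of calculus for right derivatives on `[0, ∞)`. -/
theorem integral_eq_sub_of_hasRightDeriv {g g' : ℝ≥0 → 𝕜} (hg : Continuous g) (hg' : Continuous g')
    (h : ∀ r, HasRightDeriv 𝕜 g (g' r) r) (a : ℝ≥0) :
    ∫ r in (0 : ℝ)..a, g' r.toNNReal = g a - g 0 := by
  have := intervalIntegral.integral_eq_sub_of_hasDeriv_right_of_le (a := 0) (b := (a : ℝ))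
    (f := fun r => g r.toNNReal) (f' := fun r => g' r.toNNReal) a.2
    (hg.comp continuous_real_toNNReal).continuousOn (fun x hx => ?_)
    ((hg'.comp continuous_real_toNNReal).intervalIntegrable _ _)
  · simpa using this
  · rw [hasDerivWithinAt_iff_tendsto_slope' (by simp)]
    have h1 : Tendsto (fun y : ℝ => (y - x).toNNReal) (𝓝[>] x) (𝓝[>] 0) := by
      refine tendsto_nhdsWithin_iff.2 ⟨?_, ?_⟩
      · have : Continuous fun y : ℝ => (y - x).toNNReal := by fun_prop
        simpa using (this.tendsto x).mono_left nhdsWithin_le_nhds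
      · filter_upwards [self_mem_nhdsWithin] with y hy
        simpa using hy
    refine ((h x.toNNReal).comp h1).congr' ?_
    filter_upwards [self_mem_nhdsWithin] with y hy
    have hxy : x < y := hy
    have e1 : x.toNNReal + (y - x).toNNReal = y.toNNReal := by
      rw [← Real.toNNReal_add hx.1.le (by linarith)]; congr 1; ring
    rw [Function.comp, e1, slope, vsub_eq_sub, Real.coe_toNNReal _ (by linarith),
      RCLike.real_smul_eq_coe_smul (K := 𝕜)]
    push_cast
    rfl

end Adjoint

/-! ### Mild solutions -/

section WeakSolution

variable {𝕜 E : Type*} [RCLike 𝕜] [AddCommGroup E] [Module 𝕜 E] [UniformSpace E]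
  [IsUniformAddGroup E] [ContinuousSMul 𝕜 E] [PolynormableSpace 𝕜 E]

/-- The weak limit `v` of the step evolutions of `f` is a mild solution:
`Z (∫₀ᵃ v) = v(a) - f`. By Hahn-Banach it suffices to test with `φ, ψ` such that `φ + ψ ∘ Z = 0` on
the domain. Approximating `ψ` pointwise by `ψ_k` in the domain of the derivative of the adjoint,
`ψ_k(v(a)) - ψ_k(f)` is the integral of `ψ_k ∘ Z ∘ v`, and these integrands are uniformly bounded, so
that dominated convergence applies. -/
theorem MemF.mem_graph_of_isWeakIntegral [T2Space E] [CompleteSpace E] {F : ℝ≥0 → E →L[𝕜] E}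
    (hF : MemF F)
    (hstar : StarDense ((strongDeriv (adjointFun F)).domain : Set (StrongDual 𝕜 E)))
    {Z : E →ₗ.[𝕜] E} (hZ : Z.IsClosed) (hZF : Z.graph ≤ (mefGraph F).topologicalClosure)
    {f g : E} (hfg : (f, g) ∈ mefGraph F) {h : ℕ → ℝ≥0} (hh : Tendsto h atTop (𝓝[>] 0))
    {v : ℝ≥0 → E} (hv : ∀ s, WeakLim 𝕜 (fun k => (F (h k) ^ ⌊s / h k⌋₊) f) (v s))
    (hvZ : ∀ s, v s ∈ Z.domain) {a : ℝ≥0} {I : E} (hI : IsWeakIntegral 𝕜 v a I) :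
    (I, v a - f) ∈ Z.graph := by
  have hvc : Continuous v := hF.continuous_of_weakLim_step hh hv
  have hv0 : v 0 = f := by
    refine eq_of_forall_dual_eq 𝕜 fun φ => tendsto_nhds_unique (hv 0 φ) ?_
    simp
  refine mem_of_forall_pair_eq_zero hZ fun φ ψ hφψ => ?_
  obtain ⟨Ψ, hΨ, hlim⟩ := hstar ψ
  let Ψ' : ℕ → StrongDual 𝕜 E := fun k => strongDeriv (adjointFun F) ⟨Ψ k, hΨ k⟩
  have hΨ' : ∀ k, (Ψ k, Ψ' k) ∈ derivGraph (adjointFun F) := fun k => by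
    rw [← strongDeriv_graph]
    exact (strongDeriv (adjointFun F)).mem_graph ⟨Ψ k, hΨ k⟩
  obtain ⟨B, hB, hBψ⟩ := hF.exists_bounded_forall_dual_le hfg hh hv a
  obtain ⟨M, hM⟩ := exists_bound_of_pointwise_bounded (ψ := Ψ) (fun x => by
    obtain ⟨C, hC⟩ := (hlim x).norm.bddAbove_range
    exact ⟨C, fun k => hC ⟨k, rfl⟩⟩) hB
  have hint : ∀ k, ∫ r in (0 : ℝ)..a, Ψ' k (v r.toNNReal) = Ψ k (v a) - Ψ k (v 0) := fun k =>
    integral_eq_sub_of_hasRightDeriv (g := fun r => Ψ k (v r)) (g' := fun r => Ψ' k (v r))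
      ((Ψ k).continuous.comp hvc) ((Ψ' k).continuous.comp hvc)
      (fun r => hF.hasRightDeriv_dual_weakLim hh hv (hΨ' k) r) a
  have hpt : ∀ r, Tendsto (fun k => Ψ' k (v r)) atTop (𝓝 (-φ (v r))) := by
    intro r
    have hgr : (v r, Z ⟨v r, hvZ r⟩) ∈ Z.graph := Z.mem_graph ⟨v r, hvZ r⟩
    have e1 : ∀ k, Ψ' k (v r) = Ψ k (Z ⟨v r, hvZ r⟩) := fun k =>
      dual_eq_of_mem_closure (hΨ' k) (hZF hgr)
    have e2 : -φ (v r) = ψ (Z ⟨v r, hvZ r⟩) := by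
      rw [neg_eq_iff_add_eq_zero]
      exact hφψ _ hgr
    simp only [e1, e2]
    exact hlim _
  have hl1 : Tendsto (fun k => ∫ r in (0 : ℝ)..a, Ψ' k (v r.toNNReal)) atTop
      (𝓝 (∫ r in (0 : ℝ)..a, -φ (v r.toNNReal))) := by
    refine intervalIntegral.tendsto_integral_filter_of_dominated_convergence (fun _ => M) ?_ ?_ ?_ ?_
    · exact Eventually.of_forall fun k => (continuous_dual_comp hvc (Ψ' k)).aestronglyMeasurable
    · refine Eventually.of_forall fun k => Eventually.of_forall fun r hr => ?_
      refine hBψ _ _ (hΨ' k) M (hM k) _ ?_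
      rw [Set.uIoc_of_le (show (0 : ℝ) ≤ a from a.2)] at hr
      exact Real.toNNReal_le_iff_le_coe.2 hr.2
    · simp
    · exact Eventually.of_forall fun r _ => hpt _
  have hl2 : Tendsto (fun k => ∫ r in (0 : ℝ)..a, Ψ' k (v r.toNNReal)) atTop
      (𝓝 (ψ (v a) - ψ (v 0))) := by
    simp only [hint]
    exact (hlim _).sub (hlim _)
  have key := tendsto_nhds_unique hl1 hl2
  rw [intervalIntegral.integral_neg, ← hI φ, hv0, ← map_sub] at key
  rw [← key, add_neg_cancel]

end WeakSolution

/-! ### The limit semigroup -/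

section Semigroup

variable {𝕜 E : Type*} [RCLike 𝕜] [AddCommGroup E] [Module 𝕜 E] [UniformSpace E]
  [IsUniformAddGroup E] [ContinuousSMul 𝕜 E] [PolynormableSpace 𝕜 E]

theorem equicontinuous_of_seminorm_bound {S : Set (E →L[𝕜] E)}
    (h : ∀ p : Seminorm 𝕜 E, Continuous p → ∃ q : Seminorm 𝕜 E, Continuous q ∧
      ∀ g ∈ S, ∀ x, p (g x) ≤ q x) :
    Equicontinuous (fun g : S => ⇑(g : E →L[𝕜] E)) := by
  have H := ((PolynormableSpace.withSeminorms 𝕜 E).equicontinuous_TFAE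
    (fun g : S => ((g : E →L[𝕜] E) : E →ₗ[𝕜] E))).out 1 3
  refine H.2 fun p => ?_
  obtain ⟨q, hq, hq'⟩ := h p.1 p.2
  exact ⟨q, hq, fun g x => hq' g g.2 x⟩

omit [ContinuousSMul 𝕜 E] in
theorem continuous_of_seminorm_bound (L : E →ₗ[𝕜] E)
    (h : ∀ p : Seminorm 𝕜 E, Continuous p → ∃ q : Seminorm 𝕜 E, Continuous q ∧
      ∀ x, p (L x) ≤ q x) : Continuous L := by
  refine continuous_of_continuousAt_zero L ((tendsto_iff_seminorm 𝕜).2 fun p hp ε hε => ?_)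
  obtain ⟨q, hq, hb⟩ := h p hp
  filter_upwards [(hq.tendsto 0).eventually_lt_const (by simpa using hε)] with x hx
  rw [map_zero, sub_zero]
  exact (hb x).trans_lt hx

omit [ContinuousSMul 𝕜 E] [PolynormableSpace 𝕜 E] in
theorem pow_eq_of_map_add {T : ℝ≥0 → E →L[𝕜] E} (h0 : T 0 = 1) (hadd : ∀ l m, T (l + m) = T l * T m)
    (r : ℝ≥0) (m : ℕ) : T r ^ m = T (m * r) := by
  induction m with
  | zero => simp [h0]
  | succ m ih => rw [pow_succ, ih, ← hadd]; congr 1; push_cast; ring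

theorem MemF.tendsto_step_add {F : ℝ≥0 → E →L[𝕜] E} (hF : MemF F) {l m : ℝ≥0} {f g k : E}
    (hg : Tendsto (fun h => (F h ^ ⌊m / h⌋₊) f) (𝓝[>] 0) (𝓝 g))
    (hk : Tendsto (fun h => (F h ^ ⌊l / h⌋₊) g) (𝓝[>] 0) (𝓝 k)) :
    Tendsto (fun h => (F h ^ ⌊(l + m) / h⌋₊) f) (𝓝[>] 0) (𝓝 k) := by
  refine (tendsto_iff_seminorm 𝕜).2 fun p hp ε hε => ?_
  obtain ⟨q, hq, hb⟩ := hF.exists_bound (l + m) hp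
  obtain ⟨δ, hδ, hd⟩ := hF.exists_pow_sub_le f hq (show 0 < ε / 4 by positivity)
  filter_upwards [hd, Ioc_mem_nhdsGT hδ, (tendsto_iff_seminorm 𝕜).1 hg q hq (ε / 4) (by positivity),
    (tendsto_iff_seminorm 𝕜).1 hk p hp (ε / 4) (by positivity)] with h h1 h2 h3 h4
  have h0 : 0 < h := h2.1
  have hl := natFloor_mul_le (δ := l) h0
  have hm := natFloor_mul_le (δ := m) h0
  have hlm : (⌊l / h⌋₊ + ⌊m / h⌋₊ : ℕ) * h ≤ l + m := by
    push_cast; rw [add_mul]; exact add_le_add hl hm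
  -- The integer parts of `l / h` and `m / h` add up to that of `(l + m) / h`, up to one.
  obtain ⟨e, he, he1⟩ : ∃ e : ℕ, ⌊(l + m) / h⌋₊ = (⌊l / h⌋₊ + ⌊m / h⌋₊) + e ∧ e ≤ 1 := by
    refine ⟨⌊(l + m) / h⌋₊ - (⌊l / h⌋₊ + ⌊m / h⌋₊), ?_, ?_⟩
    · refine (Nat.add_sub_of_le (Nat.le_floor ?_)).symm
      rw [le_div_iff₀ h0]; exact hlm
    · have a1 : ⌊(l + m) / h⌋₊ < ⌊l / h⌋₊ + ⌊m / h⌋₊ + 2 := by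
        rw [Nat.floor_lt (by positivity), add_div]
        push_cast
        have a2 := Nat.lt_floor_add_one (l / h)
        have a3 := Nat.lt_floor_add_one (m / h)
        calc _ < _ := add_lt_add a2 a3
          _ = _ := by ring
      omega
  have heh : e * h ≤ δ := by
    calc (e : ℝ≥0) * h ≤ 1 * h := by gcongr; exact_mod_cast he1
      _ ≤ δ := by rw [one_mul]; exact h2.2
  have e1 : (F h ^ ⌊(l + m) / h⌋₊) f - k
      = (F h ^ (⌊l / h⌋₊ + ⌊m / h⌋₊)) ((F h ^ e) f - f)
        + ((F h ^ ⌊l / h⌋₊) ((F h ^ ⌊m / h⌋₊) f - g) + ((F h ^ ⌊l / h⌋₊) g - k)) := by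
    rw [he, pow_add _ _ e, pow_add, mul_apply_eq_comp, map_sub, map_sub, mul_apply_eq_comp,
      mul_apply_eq_comp]
    abel
  rw [e1]
  have b1 := (hb h _ hlm ((F h ^ e) f - f)).trans (h1 e heh)
  have b2 := hb h _ (hl.trans (le_add_of_nonneg_right m.2)) ((F h ^ ⌊m / h⌋₊) f - g)
  refine (map_add_le_add _ _ _).trans_lt ?_
  have b3 := map_add_le_add p ((F h ^ ⌊l / h⌋₊) ((F h ^ ⌊m / h⌋₊) f - g)) ((F h ^ ⌊l / h⌋₊) g - k)
  linarith

/-- If all step evolutions converge, their limit is a locally equicontinuous semigroup. -/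
theorem MemF.exists_semigroup [T2Space E] {F : ℝ≥0 → E →L[𝕜] E} (hF : MemF F)
    (hlim : ∀ s f, ∃ g, Tendsto (fun h => (F h ^ ⌊s / h⌋₊) f) (𝓝[>] (0 : ℝ≥0)) (𝓝 g)) :
    ∃ T : ℝ≥0 → E →L[𝕜] E, IsLCSemigroup T ∧
      ∀ s f, Tendsto (fun h => (F h ^ ⌊s / h⌋₊) f) (𝓝[>] 0) (𝓝 (T s f)) := by
  choose T₀ hT₀ using hlim
  have hbound : ∀ (s : ℝ≥0) (p : Seminorm 𝕜 E), Continuous p → ∃ q : Seminorm 𝕜 E, Continuous q ∧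
      ∀ r ≤ s, ∀ x, p (T₀ r x) ≤ q x := by
    intro s p hp
    obtain ⟨q, hq, hb⟩ := hF.exists_bound s hp
    refine ⟨q, hq, fun r hr x => le_of_tendsto ((hp.tendsto _).comp (hT₀ r x)) ?_⟩
    filter_upwards [self_mem_nhdsWithin] with h h0
    exact hb h _ ((natFloor_mul_le h0).trans hr) x
  let L : ℝ≥0 → E →ₗ[𝕜] E := fun s =>
    { toFun := T₀ s
      map_add' := fun x y => tendsto_nhds_unique (hT₀ s (x + y)) <| by
        simpa using (hT₀ s x).add (hT₀ s y)
      map_smul' := fun c x => tendsto_nhds_unique (hT₀ s (c • x)) <| by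
        simpa using (hT₀ s x).const_smul c }
  let T : ℝ≥0 → E →L[𝕜] E := fun s => ⟨L s, continuous_of_seminorm_bound _ fun p hp => by
    obtain ⟨q, hq, hb⟩ := hbound s p hp
    exact ⟨q, hq, hb s le_rfl⟩⟩
  have hT : ∀ s f, Tendsto (fun h => (F h ^ ⌊s / h⌋₊) f) (𝓝[>] 0) (𝓝 (T s f)) := hT₀
  have h0 : T 0 = 1 := by
    ext f
    refine tendsto_nhds_unique (hT 0 f) ?_
    simp
  have hadd : ∀ l m, T (l + m) = T l * T m := by
    intro l m
    ext f
    exact tendsto_nhds_unique (hT _ f) (hF.tendsto_step_add (hT m f) (hT l _))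
  refine ⟨T, ⟨⟨h0, fun s => equicontinuous_of_seminorm_bound fun p hp => ?_⟩, hadd, fun x => ?_⟩, hT⟩
  · obtain ⟨q, hq, hb⟩ := hbound s p hp
    refine ⟨q, hq, ?_⟩
    rintro _ ⟨n, m, d, -, -, hmd, rfl⟩ x
    rw [pow_eq_of_map_add h0 hadd]
    exact hb _ (by rwa [← mul_div_assoc]) x
  · have hh : Tendsto (fun k : ℕ => (1 : ℝ≥0) / (id k : ℕ)) atTop (𝓝[>] 0) :=
      tendsto_div_nat one_pos strictMono_id
    exact hF.continuous_of_weakLim_step hh fun s φ =>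
      (φ.continuous.tendsto _).comp ((hT s x).comp hh)

end Semigroup

/-! ### The generator and the product formula -/

section Generator

variable {𝕜 E : Type*} [RCLike 𝕜] [AddCommGroup E] [Module 𝕜 E] [UniformSpace E]
  [IsUniformAddGroup E] [ContinuousSMul 𝕜 E] [PolynormableSpace 𝕜 E]

omit [IsUniformAddGroup E] [ContinuousSMul 𝕜 E] [PolynormableSpace 𝕜 E] in
theorem IsLCSemigroup.diffQuot_comm {T : ℝ≥0 → E →L[𝕜] E} (hT : IsLCSemigroup T) (s d : ℝ≥0)
    (x : E) : diffQuot T d (T s x) = T s (diffQuot T d x) := by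
  have e : T d (T s x) = T s (T d x) := by
    rw [← mul_apply_eq_comp, ← mul_apply_eq_comp, ← hT.map_add, ← hT.map_add, add_comm]
  simp only [diffQuot, hT.map_zero, map_smul, map_sub, e]
  rfl

omit [PolynormableSpace 𝕜 E] in
theorem IsLCSemigroup.mem_derivGraph_apply {T : ℝ≥0 → E →L[𝕜] E} (hT : IsLCSemigroup T) (s : ℝ≥0)
    {x y : E} (hxy : (x, y) ∈ derivGraph T) : (T s x, T s y) ∈ derivGraph T := by
  have h : Tendsto (fun d => diffQuot T d x) (𝓝[>] 0) (𝓝 y) := hxy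
  change Tendsto (fun d => diffQuot T d (T s x)) (𝓝[>] 0) (𝓝 (T s y))
  simp only [hT.diffQuot_comm]
  exact ((T s).continuous.tendsto y).comp h

omit [PolynormableSpace 𝕜 E] in
theorem IsLCSemigroup.hasRightDeriv {T : ℝ≥0 → E →L[𝕜] E} (hT : IsLCSemigroup T) {x y : E}
    (hxy : (x, y) ∈ derivGraph T) (s : ℝ≥0) : HasRightDeriv 𝕜 (fun r => T r x) (T s y) s := by
  have h : Tendsto (fun d => diffQuot T d (T s x)) (𝓝[>] 0) (𝓝 (T s y)) :=
    hT.mem_derivGraph_apply s hxy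
  refine h.congr fun d => ?_
  change ((d : ℝ) : 𝕜)⁻¹ • (T d (T s x) - T 0 (T s x)) = ((d : ℝ) : 𝕜)⁻¹ • (T (s + d) x - T s x)
  rw [hT.map_zero, add_comm s d, hT.map_add]
  rfl

/-- **Chernoff product formula**: if the effective derivative of `F` extends a densely defined
operator whose closure generates `T`, then `F(t/n)^n f → T(t) f`. -/
theorem MemF.tendsto_pow_of_isGeneratorOf [T2Space E] {F : ℝ≥0 → E →L[𝕜] E} (hF : MemF F)
    {Z : E →ₗ.[𝕜] E} (hZ : Dense (Z.domain : Set E)) (hZF : Z ≤ effDeriv F)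
    {T : ℝ≥0 → E →L[𝕜] E} (hT : IsGeneratorOf Z.closure T) {t : ℝ≥0} (ht : 0 < t) (f : E) :
    Tendsto (fun n : ℕ => (F (t / n) ^ n) f) atTop (𝓝 (T t f)) := by
  obtain ⟨hT, hgen⟩ := hT
  have hgr : Z.closure.graph = derivGraph T := by rw [hgen, strongDeriv_graph]
  have h1 : ∀ x ∈ (Z.domain : Set E),
      Tendsto (fun h => (F h ^ ⌊t / h⌋₊) x) (𝓝[>] 0) (𝓝 (T t x)) := by
    intro x hx
    have hxy : (x, Z ⟨x, hx⟩) ∈ derivGraph T := by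
      rw [← hgr]
      exact LinearPMap.le_graph_of_le Z.le_closure (Z.mem_graph ⟨x, hx⟩)
    have := hF.tendsto_step (u := fun s => T s x) (y := fun s => T s (Z ⟨x, hx⟩)) (hT.continuous x)
      (fun r => hF.closure_graph_le hZF (hgr ▸ hT.mem_derivGraph_apply r hxy))
      (hT.hasRightDeriv hxy) t
    simpa [hT.map_zero] using this
  have h2 := (hF.tendsto_step_of_dense t hZ (T t) h1 f).comp (tendsto_div_nat ht strictMono_id)
  refine h2.congr' ?_
  filter_upwards [eventually_gt_atTop 0] with n hn
  have hn' : (n : ℝ≥0) ≠ 0 := by exact_mod_cast hn.ne'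
  simp only [Function.comp, id]
  rw [div_div_cancel₀ ht.ne', Nat.floor_natCast]

/-- The closure of the effective derivative of `F` is contained in the generator of the limit of the
step evolutions. -/
theorem MemF.mem_derivGraph_of_tendsto_step {F : ℝ≥0 → E →L[𝕜] E} (hF : MemF F)
    {T : ℝ≥0 → E →L[𝕜] E} (h0 : T 0 = 1)
    (hT : ∀ s f, Tendsto (fun h => (F h ^ ⌊s / h⌋₊) f) (𝓝[>] 0) (𝓝 (T s f))) {x y : E}
    (hxy : (x, y) ∈ (mefGraph F).topologicalClosure) : (x, y) ∈ derivGraph T := by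
  suffices H : HasRightDeriv 𝕜 (fun s => T s x) y 0 by
    have : Tendsto (fun d => diffQuot T d x) (𝓝[>] 0) (𝓝 y) := by
      refine H.congr fun d => ?_
      rw [diffQuot, zero_add]
    exact this
  refine hasRightDeriv_iff.2 fun p hp ε hε => ?_
  obtain ⟨δ, hδ, hd⟩ := hF.exists_pow_expansion hxy hp hε
  refine ⟨δ, hδ, fun d hdδ => le_of_forall_pos_le_add fun η hη => ?_⟩
  rw [zero_add, h0]
  have hκ : Tendsto (fun h : ℝ≥0 => (((⌊d / h⌋₊ : ℕ) * h : ℝ≥0) : ℝ)) (𝓝[>] 0) (𝓝 d) := by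
    rw [tendsto_iff_dist_tendsto_zero]
    refine squeeze_zero' (Eventually.of_forall fun _ => dist_nonneg) ?_ tendsto_coe_nhdsGT_zero
    filter_upwards [self_mem_nhdsWithin] with h h0
    have := abs_natFloor_sub_mul_sub_le (r := 0) (d := d) h0
    rw [Real.dist_eq]
    simpa using this
  have hl1 : Tendsto (fun h => p ((F h ^ ⌊d / h⌋₊) x - x
      - (((((⌊d / h⌋₊ : ℕ) * h : ℝ≥0) : ℝ)) : 𝕜) • y)) (𝓝[>] 0)
      (𝓝 (p (T d x - x - ((d : ℝ) : 𝕜) • y))) :=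
    (hp.tendsto _).comp (((hT d x).sub_const x).sub
      ((((RCLike.continuous_ofReal (K := 𝕜)).tendsto _).comp hκ).smul_const y))
  have hl2 : Tendsto (fun h : ℝ≥0 => ε * (((⌊d / h⌋₊ : ℕ) * h : ℝ≥0) : ℝ) + η) (𝓝[>] 0)
      (𝓝 (ε * d + η)) := (hκ.const_mul ε).add_const η
  refine le_of_tendsto_of_tendsto hl1 hl2 ?_
  filter_upwards [hd η hη, self_mem_nhdsWithin] with h hh h0
  have := hh ⌊d / h⌋₊ ((natFloor_mul_le h0).trans hdδ)
  simpa using this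

/-- If the integrated semigroup identity `Z (∫₀ᵃ T(r) f dr) = T(a) f - f` holds for `f` in a dense
set, then the closed operator `Z` contains the generator of `T`. -/
theorem IsLCSemigroup.derivGraph_le [T2Space E] [CompleteSpace E] {T : ℝ≥0 → E →L[𝕜] E}
    (hT : IsLCSemigroup T) {S : Submodule 𝕜 (E × E)} (hS : IsClosed (S : Set (E × E))) {A : Set E}
    (hA : Dense A)
    (h : ∀ f ∈ A, ∀ a I, IsWeakIntegral 𝕜 (fun r => T r f) a I → (I, T a f - f) ∈ S) :
    derivGraph T ≤ S := by
  rintro ⟨x, y⟩ hxy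
  have hxy' : Tendsto (fun d => diffQuot T d x) (𝓝[>] 0) (𝓝 y) := hxy
  choose I hI using fun (f : E) (a : ℝ≥0) => exists_isWeakIntegral 𝕜 (hT.continuous f) a
  refine mem_of_forall_pair_eq_zero hS fun φ ψ hφψ => ?_
  -- The annihilation relation extends from the dense set to the whole space.
  have hall : ∀ a, φ (I x a) + ψ (T a x - x) = 0 := by
    intro a
    refine norm_eq_zero.1 (le_antisymm (le_of_forall_pos_le_add fun ε hε => ?_) (norm_nonneg _))
    rw [zero_add]
    obtain ⟨q, hq, hb⟩ := hT.exists_bound a (p := φ.toSeminorm) φ.continuous.norm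
    let P : Seminorm 𝕜 E := q ⊔ (ψ.comp (T a - 1)).toSeminorm
    have hP : Continuous P := hq.sup (ψ.comp (T a - 1)).continuous.norm
    obtain ⟨f, hf, hfx⟩ := exists_near_of_dense hA x hP (show 0 < ε / (a + 1) by positivity)
    have hfx' : max (q (f - x)) ‖ψ ((T a - 1) (f - x))‖ < ε / (a + 1) := hfx
    rw [max_lt_iff] at hfx'
    have h1 : φ (I f a) + ψ (T a f - f) = 0 := hφψ _ (h f hf a _ (hI f a))
    have h2 : φ (I f a) - φ (I x a) = ∫ r in (0 : ℝ)..a, φ (T r.toNNReal (f - x)) := by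
      rw [hI f a, hI x a, ← intervalIntegral.integral_sub
        ((continuous_dual_comp (hT.continuous f) φ).intervalIntegrable _ _)
        ((continuous_dual_comp (hT.continuous x) φ).intervalIntegrable _ _)]
      simp only [map_sub]
    have h3 : ‖φ (I f a) - φ (I x a)‖ ≤ ε / (a + 1) * a := by
      rw [h2]
      refine (intervalIntegral.norm_integral_le_of_norm_le_const (C := ε / (a + 1)) ?_).trans_eq ?_
      · intro r hr
        rw [Set.uIoc_of_le (show (0 : ℝ) ≤ a from a.2)] at hr
        have := hb r.toNNReal 1 (by simpa using Real.toNNReal_le_iff_le_coe.2 hr.2) (f - x)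
        rw [pow_one] at this
        exact le_trans this hfx'.1.le
      · simp
    have e : φ (I x a) + ψ (T a x - x)
        = -((φ (I f a) - φ (I x a)) + ψ ((T a - 1) (f - x))) := by
      have e1 : ψ ((T a - 1) (f - x)) = ψ (T a f - f) - ψ (T a x - x) := by
        rw [← map_sub ψ]
        congr 1
        simp only [sub_apply, map_sub, one_apply_eq_self]
      rw [e1]
      linear_combination h1
    rw [e, norm_neg]
    calc _ ≤ ε / (a + 1) * a + ε / (a + 1) := (norm_add_le _ _).trans (add_le_add h3 hfx'.2.le)
      _ = ε := by field_simp
  have hI0 : I x 0 = 0 := (hI x 0).eq_zero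
  have h1 : Tendsto (fun d : ℝ≥0 => ((d : ℝ) : 𝕜)⁻¹ • I x d) (𝓝[>] 0) (𝓝 x) := by
    have := hasRightDeriv_weakIntegral (hT.continuous x) (hI x) 0
    simpa [HasRightDeriv, hI0, hT.map_zero] using this
  refine tendsto_nhds_unique (((φ.continuous.tendsto x).comp h1).add
    ((ψ.continuous.tendsto y).comp hxy')) ?_
  refine tendsto_const_nhds.congr fun d => ?_
  have := hall d
  simp only [Function.comp, diffQuot, map_smul, hT.map_zero, one_apply_eq_self]
  rw [← smul_add, this, smul_zero]

/-- Sufficiency of the generation conditions. -/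
theorem GenerationConditions.exists_isGeneratorOf [T2Space E] [CompleteSpace E]
    {F : ℝ≥0 → E →L[𝕜] E} (hF : MemF F) {Z : E →ₗ.[𝕜] E} {t : ℝ≥0} (ht : 0 < t)
    (hG : GenerationConditions Z t F) : ∃ T : ℝ≥0 → E →L[𝕜] E, IsGeneratorOf Z.closure T := by
  obtain ⟨hZF, hstar, A, hAZ, hA, happ⟩ := hG
  have hcl : Z.closure.IsClosed := (hF.isClosable hZF).closure_isClosed
  have hgr := hF.closure_graph_le hZF
  -- For `f ∈ A` there is a mild solution `v` of the Cauchy problem with integral `I`.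
  have hsol : ∀ f ∈ A, ∃ v I : ℝ≥0 → E, ∃ h : ℕ → ℝ≥0, Tendsto h atTop (𝓝[>] 0) ∧ Continuous v ∧
      (∀ s, WeakLim 𝕜 (fun k => (F (h k) ^ ⌊s / h k⌋₊) f) (v s)) ∧
      (∀ a, IsWeakIntegral 𝕜 v a (I a)) ∧ v 0 = f ∧ ∀ a, (I a, v a - f) ∈ Z.closure.graph := by
    intro f hf
    obtain ⟨σ, hσ, v, hvZ, hv⟩ := hF.exists_weakLim_step ht f (D := Z.closure.domain)
      fun s σ hσ => by
        obtain ⟨a, h1, h2, h3⟩ := happ f hf s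
        obtain ⟨θ, hθ, x, hx, hlim⟩ := exists_weakLim_mem_domain hcl h1 h2 h3 hσ
        exact ⟨θ, hθ, x, hx, by simpa only [natCast_mul_div] using hlim⟩
    have hh := tendsto_div_nat ht hσ
    have hvc := hF.continuous_of_weakLim_step hh hv
    choose I hI using exists_isWeakIntegral 𝕜 hvc
    have hfg : (f, Z ⟨f, hAZ hf⟩) ∈ mefGraph F :=
      hF.graph_le_mefGraph hZF (Z.mem_graph ⟨f, hAZ hf⟩)
    have hv0 : v 0 = f := by
      refine eq_of_forall_dual_eq 𝕜 fun φ => tendsto_nhds_unique (hv 0 φ) ?_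
      simp
    exact ⟨v, I, _, hh, hvc, hv, hI, hv0, fun a =>
      hF.mem_graph_of_isWeakIntegral hstar hcl hgr hfg hh hv hvZ (hI a)⟩
  -- Averages of `v` are classical solutions, so the step evolutions of `I(a)` converge strongly.
  let D : Set E := {g | ∀ s, ∃ k, Tendsto (fun h => (F h ^ ⌊s / h⌋₊) g) (𝓝[>] (0 : ℝ≥0)) (𝓝 k)}
  have hD : Dense D := by
    refine Dense.of_closure (hA.mono fun f hf => ?_)
    obtain ⟨v, I, -, -, hvc, -, hI, hv0, hmem⟩ := hsol f hf
    have hI0 : I 0 = 0 := (hI 0).eq_zero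
    have hID : ∀ a, I a ∈ D := by
      intro a s
      have hIc := continuous_weakIntegral hvc hI
      have := hF.tendsto_step (u := fun r => I (r + a) - I r) (y := fun r => v (r + a) - v r)
        ((hIc.comp (continuous_id.add continuous_const)).sub hIc)
        (fun r => by
          have := Z.closure.graph.sub_mem (hmem (r + a)) (hmem r)
          simp only [Prod.mk_sub_mk, sub_sub_sub_cancel_right] at this
          exact hgr this)
        (fun r => by
          have := (hasRightDeriv_weakIntegral hvc hI (r + a)).sub
            (hasRightDeriv_weakIntegral hvc hI r)
          refine this.congr fun d => ?_
          change _ = ((d : ℝ) : 𝕜)⁻¹ • ((I (r + d + a) - I (r + d)) - (I (r + a) - I r))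
          rw [← smul_sub, add_right_comm r a d]
          congr 1
          abel) s
      simp only [zero_add, hI0, sub_zero] at this
      exact ⟨_, this⟩
    have hlim : Tendsto (fun d : ℝ≥0 => ((d : ℝ) : 𝕜)⁻¹ • I d) (𝓝[>] 0) (𝓝 f) := by
      have := hasRightDeriv_weakIntegral hvc hI 0
      simpa [HasRightDeriv, hI0, hv0] using this
    refine mem_closure_of_tendsto hlim (Eventually.of_forall fun d s => ?_)
    obtain ⟨k, hk⟩ := hID d s
    exact ⟨((d : ℝ) : 𝕜)⁻¹ • k, by simpa using hk.const_smul (((d : ℝ) : 𝕜)⁻¹)⟩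
  obtain ⟨T, hT, hlim⟩ := hF.exists_semigroup fun s f =>
    CompleteSpace.complete (hF.cauchy_step_of_dense s hD (fun g hg => by
      obtain ⟨k, hk⟩ := hg s
      exact hk.cauchy_map) f)
  refine ⟨T, hT, LinearPMap.eq_of_eq_graph ?_⟩
  rw [strongDeriv_graph]
  refine le_antisymm (fun w hw => hF.mem_derivGraph_of_tendsto_step hT.map_zero hlim (hgr hw)) ?_
  refine hT.derivGraph_le hcl hA fun f hf a J hJ => ?_
  obtain ⟨v, I, h, hh, -, hv, hI, -, hmem⟩ := hsol f hf
  have hTv : ∀ s, T s f = v s := fun s => eq_of_forall_dual_eq 𝕜 fun φ =>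
    tendsto_nhds_unique ((φ.continuous.tendsto _).comp ((hlim s f).comp hh)) (hv s φ)
  have hJI : J = I a := eq_of_forall_dual_eq 𝕜 fun φ => by
    rw [hJ φ, hI a φ]
    simp only [hTv]
  rw [hJI, hTv]
  exact hmem a

end Generator

/-! ### Averages in the adjoint semigroup -/

section AdjointSemigroup

variable {𝕜 E : Type*} [RCLike 𝕜] [AddCommGroup E] [Module 𝕜 E] [UniformSpace E]
  [IsUniformAddGroup E] [ContinuousSMul 𝕜 E] [PolynormableSpace 𝕜 E]

theorem IsLCSemigroup.exists_bound_apply {T : ℝ≥0 → E →L[𝕜] E} (hT : IsLCSemigroup T) (s : ℝ≥0)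
    {p : Seminorm 𝕜 E} (hp : Continuous p) :
    ∃ q : Seminorm 𝕜 E, Continuous q ∧ ∀ r ≤ s, ∀ x, p (T r x) ≤ q x := by
  obtain ⟨q, hq, hb⟩ := hT.exists_bound s hp
  exact ⟨q, hq, fun r hr x => by simpa using hb r 1 (by simpa using hr) x⟩

theorem norm_integral_le_mul {a : ℝ≥0} {g : ℝ≥0 → 𝕜} {C : ℝ} (h : ∀ r ≤ a, ‖g r‖ ≤ C) :
    ‖∫ r in (0 : ℝ)..a, g r.toNNReal‖ ≤ C * a := by
  refine (intervalIntegral.norm_integral_le_of_norm_le_const (C := C) ?_).trans_eq (by simp)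
  intro r hr
  rw [Set.uIoc_of_le (show (0 : ℝ) ≤ a from a.2)] at hr
  exact h _ (Real.toNNReal_le_iff_le_coe.2 hr.2)

/-- The linear functional `x ↦ ∫₀ᵃ φ(T(r) x) dr`. -/
noncomputable def IsLCSemigroup.dualIntegralAux {T : ℝ≥0 → E →L[𝕜] E} (hT : IsLCSemigroup T)
    (φ : StrongDual 𝕜 E) (a : ℝ≥0) : E →ₗ[𝕜] 𝕜 where
  toFun x := ∫ r in (0 : ℝ)..a, φ (T r.toNNReal x)
  map_add' x y := by
    rw [← intervalIntegral.integral_add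
      ((continuous_dual_comp (hT.continuous x) φ).intervalIntegrable _ _)
      ((continuous_dual_comp (hT.continuous y) φ).intervalIntegrable _ _)]
    exact intervalIntegral.integral_congr fun r _ => by simp
  map_smul' c x := by
    rw [RingHom.id_apply, smul_eq_mul, ← intervalIntegral.integral_const_mul]
    exact intervalIntegral.integral_congr fun r _ => by simp

/-- The functional `x ↦ ∫₀ᵃ φ(T(r) x) dr`, that is, the weak-* integral `∫₀ᵃ T(r)* φ dr`. -/
noncomputable def IsLCSemigroup.dualIntegral {T : ℝ≥0 → E →L[𝕜] E} (hT : IsLCSemigroup T)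
    (φ : StrongDual 𝕜 E) (a : ℝ≥0) : StrongDual 𝕜 E where
  toLinearMap := hT.dualIntegralAux φ a
  cont := by
    obtain ⟨q, hq, hb⟩ := hT.exists_bound_apply a (p := φ.toSeminorm) φ.continuous.norm
    refine continuous_of_continuousAt_zero (hT.dualIntegralAux φ a) ?_
    have h0 : Tendsto (fun x => q x * (a : ℝ)) (𝓝 0) (𝓝 0) := by
      have := (hq.tendsto 0).mul_const (a : ℝ)
      rwa [map_zero, zero_mul] at this
    rw [ContinuousAt, map_zero]
    exact squeeze_zero_norm
      (fun x => norm_integral_le_mul (g := fun r => φ (T r x)) fun r hr => hb r hr x) h0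

theorem IsLCSemigroup.dualIntegral_apply {T : ℝ≥0 → E →L[𝕜] E} (hT : IsLCSemigroup T)
    (φ : StrongDual 𝕜 E) (a : ℝ≥0) (x : E) :
    hT.dualIntegral φ a x = ∫ r in (0 : ℝ)..a, φ (T r.toNNReal x) := rfl

omit [IsUniformAddGroup E] [ContinuousSMul 𝕜 E] [PolynormableSpace 𝕜 E] in
theorem IsLCSemigroup.integral_apply_apply {T : ℝ≥0 → E →L[𝕜] E} (hT : IsLCSemigroup T)
    (φ : StrongDual 𝕜 E) (a s : ℝ≥0) (x : E) :
    ∫ r in (0 : ℝ)..a, φ (T r.toNNReal (T s x))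
      = (∫ r in (0 : ℝ)..(a + s : ℝ), φ (T r.toNNReal x))
        - ∫ r in (0 : ℝ)..s, φ (T r.toNNReal x) := by
  have hc := continuous_dual_comp (hT.continuous x) φ
  rw [intervalIntegral.integral_interval_sub_left (hc.intervalIntegrable _ _)
    (hc.intervalIntegrable _ _)]
  have e := intervalIntegral.integral_comp_add_right (a := 0) (b := (a : ℝ))
    (fun r : ℝ => φ (T r.toNNReal x)) (s : ℝ)
  rw [zero_add] at e
  rw [← e]
  refine intervalIntegral.integral_congr fun r hr => ?_
  rw [Set.uIcc_of_le (show (0 : ℝ) ≤ a from a.2)] at hr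
  rw [Real.toNNReal_add hr.1 s.coe_nonneg, Real.toNNReal_coe, hT.map_add]
  rfl

/-- Translating the averaged functional by `T(s)` moves only the ends of the interval. -/
theorem IsLCSemigroup.dualIntegral_apply_sub {T : ℝ≥0 → E →L[𝕜] E} (hT : IsLCSemigroup T)
    (φ : StrongDual 𝕜 E) (a s : ℝ≥0) (x : E) :
    hT.dualIntegral φ a (T s x) - hT.dualIntegral φ a x
      = ∫ r in (0 : ℝ)..s, (φ (T r.toNNReal (T a x)) - φ (T r.toNNReal x)) := by
  rw [intervalIntegral.integral_sub
    ((continuous_dual_comp (hT.continuous _) φ).intervalIntegrable _ _)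
    ((continuous_dual_comp (hT.continuous _) φ).intervalIntegrable _ _),
    hT.dualIntegral_apply, hT.dualIntegral_apply, hT.integral_apply_apply,
    hT.integral_apply_apply, add_comm (s : ℝ)]
  ring

/-- A functional whose orbit under the adjoint semigroup is continuous at `0` in the strong topology
of the dual has averages in the domain of the derivative of the adjoint. -/
theorem IsLCSemigroup.dualIntegral_mem_domain [T2Space E] {T : ℝ≥0 → E →L[𝕜] E}
    (hT : IsLCSemigroup T) (ψ : StrongDual 𝕜 E)
    (hψ : ∀ B : Set E, Bornology.IsVonNBounded 𝕜 B → ∀ ε > 0, ∃ δ > (0 : ℝ≥0), ∀ s ≤ δ, ∀ x ∈ B,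
      ‖ψ (T s x) - ψ x‖ ≤ ε) (a : ℝ≥0) :
    hT.dualIntegral ψ a ∈ (strongDeriv (adjointFun T)).domain := by
  suffices H : (hT.dualIntegral ψ a, ψ.comp (T a) - ψ) ∈ derivGraph (adjointFun T) by
    rw [← strongDeriv_graph] at H
    exact LinearPMap.mem_domain_of_mem_graph H
  suffices H : Tendsto (fun h => diffQuot (adjointFun T) h (hT.dualIntegral ψ a)
      - (ψ.comp (T a) - ψ)) (𝓝[>] 0) (𝓝 0) by
    have := H.add_const (ψ.comp (T a) - ψ)
    simp only [sub_add_cancel, zero_add] at this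
    exact this
  refine (ContinuousLinearMap.hasBasis_nhds_zero_of_basis
    Metric.nhds_basis_closedBall).tendsto_right_iff.2 ?_
  rintro ⟨B, ε⟩ ⟨hB, hε⟩
  have hε : 0 < ε := hε
  obtain ⟨δ1, hδ1, h1⟩ := hψ B hB (ε / 2) (half_pos hε)
  obtain ⟨δ2, hδ2, h2⟩ := hψ (T a '' B) (hB.image (T a)) (ε / 2) (half_pos hε)
  filter_upwards [Ioc_mem_nhdsGT (lt_min hδ1 hδ2)] with h hh x hx
  have h0 : 0 < h := hh.1
  have h0' : (0 : ℝ) < h := h0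
  obtain ⟨hh1, hh2⟩ := le_min_iff.1 hh.2
  have hne : ((h : ℝ) : 𝕜) ≠ 0 := by simpa using h0.ne'
  rw [mem_closedBall_zero_iff, sub_apply, diffQuot_adjointFun_apply]
  have e1 : hT.dualIntegral ψ a (diffQuot T h x) = ((h : ℝ) : 𝕜)⁻¹ *
      ∫ r in (0 : ℝ)..h, (ψ (T r.toNNReal (T a x)) - ψ (T r.toNNReal x)) := by
    rw [← hT.dualIntegral_apply_sub, diffQuot, map_smul, map_sub, hT.map_zero, smul_eq_mul]
    rfl
  have e2 : (ψ.comp (T a) - ψ) x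
      = ((h : ℝ) : 𝕜)⁻¹ * ∫ _r in (0 : ℝ)..h, (ψ (T a x) - ψ x) := by
    rw [intervalIntegral.integral_const, RCLike.real_smul_eq_coe_mul, sub_zero, ← mul_assoc,
      inv_mul_cancel₀ hne, one_mul]
    rfl
  have hc1 := continuous_dual_comp (hT.continuous (T a x)) ψ
  have hc2 := continuous_dual_comp (hT.continuous x) ψ
  have hc : Continuous fun r : ℝ => ψ (T r.toNNReal (T a x)) - ψ (T r.toNNReal x) := hc1.sub hc2
  rw [e1, e2, ← mul_sub, ← intervalIntegral.integral_sub
    (hc.intervalIntegrable _ _) (by simp), norm_mul, norm_inv, RCLike.norm_ofReal,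
    abs_of_pos h0', inv_mul_le_iff₀ h0', mul_comm]
  refine norm_integral_le_mul (a := h)
    (g := fun r => ψ (T r (T a x)) - ψ (T r x) - (ψ (T a x) - ψ x)) fun r hr => ?_
  have b1 := h1 r (hr.trans hh1) x hx
  have b2 := h2 r (hr.trans hh2) (T a x) ⟨x, hx, rfl⟩
  calc _ = ‖(ψ (T r (T a x)) - ψ (T a x)) - (ψ (T r x) - ψ x)‖ := by congr 1; ring
    _ ≤ _ := norm_sub_le _ _
    _ ≤ ε := by linarith

/-- Averaging makes the orbits of the adjoint semigroup continuous at `0` in the strong topology. -/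
theorem IsLCSemigroup.dualIntegral_continuous {T : ℝ≥0 → E →L[𝕜] E} (hT : IsLCSemigroup T)
    (φ : StrongDual 𝕜 E) (a : ℝ≥0) (B : Set E) (hB : Bornology.IsVonNBounded 𝕜 B) (ε : ℝ)
    (hε : 0 < ε) : ∃ δ > (0 : ℝ≥0), ∀ s ≤ δ, ∀ x ∈ B,
      ‖hT.dualIntegral φ a (T s x) - hT.dualIntegral φ a x‖ ≤ ε := by
  obtain ⟨q, hq, hb⟩ := hT.exists_bound_apply (1 + a) (p := φ.toSeminorm) φ.continuous.norm
  obtain ⟨C, hC⟩ := isVonNBounded_iff_seminorm.1 hB q hq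
  have hC1 : 0 < |C| + 1 := by positivity
  refine ⟨min 1 (ε / (2 * (|C| + 1))).toNNReal, lt_min one_pos (by simpa using by positivity),
    fun s hs x hx => ?_⟩
  obtain ⟨hs1, hs2⟩ := le_min_iff.1 hs
  have hs3 : (s : ℝ) ≤ ε / (2 * (|C| + 1)) := by
    have := NNReal.coe_le_coe.2 hs2
    rwa [Real.coe_toNNReal _ (by positivity)] at this
  rw [hT.dualIntegral_apply_sub]
  refine (norm_integral_le_mul (g := fun r => φ (T r (T a x)) - φ (T r x))
    (C := 2 * (|C| + 1)) fun r hr => ?_).trans ?_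
  · have c1 : ‖φ (T (r + a) x)‖ ≤ q x := hb (r + a) (by gcongr; exact hr.trans hs1) x
    have c2 : ‖φ (T r x)‖ ≤ q x := hb r ((hr.trans hs1).trans (le_add_of_nonneg_right a.2)) x
    have c3 := (hC x hx).trans (le_abs_self C)
    rw [hT.map_add] at c1
    refine (norm_sub_le _ _).trans ?_
    have c4 : ‖φ (T r (T a x))‖ ≤ q x := c1
    linarith
  · calc _ ≤ 2 * (|C| + 1) * (ε / (2 * (|C| + 1))) := by gcongr
      _ = ε := by field_simp

/-- For a locally equicontinuous semigroup the derivative of the adjoint is *-densely defined: the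
double averages `n² ∫∫ φ(T(r + s) x) dr ds` over `[0, 1/n]²` lie in its domain. (A single average is
in general only weak-* differentiable.) -/
theorem IsLCSemigroup.starDense [T2Space E] {T : ℝ≥0 → E →L[𝕜] E} (hT : IsLCSemigroup T) :
    StarDense ((strongDeriv (adjointFun T)).domain : Set (StrongDual 𝕜 E)) := by
  intro φ
  let a : ℕ → ℝ≥0 := fun k => 1 / (k + 1)
  have ha0 : ∀ k, 0 < a k := fun k => by positivity
  refine ⟨fun k => ((((a k : ℝ) : 𝕜) * ((a k : ℝ) : 𝕜))⁻¹) •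
    hT.dualIntegral (hT.dualIntegral φ (a k)) (a k), fun k => ?_, fun x => ?_⟩
  · exact Submodule.smul_mem _ _ (hT.dualIntegral_mem_domain _ (hT.dualIntegral_continuous _ _) _)
  · refine Metric.tendsto_nhds.2 fun ε hε => ?_
    have h1 : ∀ᶠ r in 𝓝 (0 : ℝ≥0), dist (φ (T r x)) (φ (T 0 x)) < ε / 2 :=
      Metric.tendsto_nhds.1 ((φ.continuous.comp (hT.continuous x)).tendsto 0) _ (half_pos hε)
    obtain ⟨δ, hδ, H⟩ := nnreal_exists_of_eventually (h1.filter_mono nhdsWithin_le_nhds)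
    have H' : ∀ r ≤ δ, ‖φ (T r x) - φ x‖ ≤ ε / 2 := by
      intro r hr
      rcases eq_or_lt_of_le (zero_le (a := r)) with rfl | hr0
      · simpa [hT.map_zero] using (half_pos hε).le
      · have := (H r hr0 hr).le
        rwa [dist_eq_norm, hT.map_zero] at this
    have hlim : Tendsto a atTop (𝓝 0) := tendsto_one_div_add_atTop_nhds_zero_nat
    filter_upwards [hlim.eventually_lt_const (show 0 < δ / 2 by positivity)] with k hk
    have hk0 : (0 : ℝ) < a k := ha0 k
    have hne : ((a k : ℝ) : 𝕜) ≠ 0 := by simpa using (ha0 k).ne'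
    have e1 : ∀ y : 𝕜, ((a k : ℝ) : 𝕜) * y = ∫ _r in (0 : ℝ)..a k, y := fun y => by
      rw [intervalIntegral.integral_const, RCLike.real_smul_eq_coe_mul, sub_zero]
    have b1 : ∀ s ≤ a k, ‖hT.dualIntegral φ (a k) (T s x) - ((a k : ℝ) : 𝕜) * φ x‖
        ≤ ε / 2 * a k := by
      intro s hs
      rw [e1, hT.dualIntegral_apply, ← intervalIntegral.integral_sub
        ((continuous_dual_comp (hT.continuous _) φ).intervalIntegrable _ _) (by simp)]
      refine norm_integral_le_mul (g := fun r => φ (T r (T s x)) - φ x) fun r hr => ?_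
      have := H' (r + s) ((add_le_add (hr.trans hk.le) (hs.trans hk.le)).trans_eq (add_halves δ))
      rw [hT.map_add] at this
      exact this
    have b2 : ‖hT.dualIntegral (hT.dualIntegral φ (a k)) (a k) x
        - ((a k : ℝ) : 𝕜) * (((a k : ℝ) : 𝕜) * φ x)‖ ≤ ε / 2 * a k * a k := by
      rw [e1 (((a k : ℝ) : 𝕜) * φ x), hT.dualIntegral_apply, ← intervalIntegral.integral_sub
        ((continuous_dual_comp (hT.continuous _) _).intervalIntegrable _ _) (by simp)]
      exact norm_integral_le_mul
        (g := fun s => hT.dualIntegral φ (a k) (T s x) - ((a k : ℝ) : 𝕜) * φ x) b1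
    rw [dist_eq_norm, smul_apply, smul_eq_mul]
    have e2 : (((a k : ℝ) : 𝕜) * ((a k : ℝ) : 𝕜))⁻¹ *
          hT.dualIntegral (hT.dualIntegral φ (a k)) (a k) x - φ x
        = (((a k : ℝ) : 𝕜) * ((a k : ℝ) : 𝕜))⁻¹ *
          (hT.dualIntegral (hT.dualIntegral φ (a k)) (a k) x
            - ((a k : ℝ) : 𝕜) * (((a k : ℝ) : 𝕜) * φ x)) := by
      field_simp
    rw [e2, norm_mul, norm_inv, norm_mul, RCLike.norm_ofReal, abs_of_pos hk0]
    refine lt_of_le_of_lt ?_ (half_lt_self hε)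
    rw [inv_mul_le_iff₀ (by positivity)]
    linarith

end AdjointSemigroup

/-! ### Necessity of the generation conditions -/

section Necessity

variable {𝕜 E : Type*} [RCLike 𝕜] [AddCommGroup E] [Module 𝕜 E] [UniformSpace E]
  [IsUniformAddGroup E] [ContinuousSMul 𝕜 E] [PolynormableSpace 𝕜 E]

omit [IsUniformAddGroup E] [ContinuousSMul 𝕜 E] [PolynormableSpace 𝕜 E] in
theorem weakSeqRelCompact_of_tendsto {u : ℕ → E} {x : E} (h : Tendsto u atTop (𝓝 x)) :
    WeakSeqRelCompact 𝕜 u := fun _ hσ =>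
  ⟨id, strictMono_id, x, fun φ => (φ.continuous.tendsto x).comp (h.comp hσ.tendsto_atTop)⟩

omit [PolynormableSpace 𝕜 E] in
/-- The derivative is contained in the effective derivative: take the constant family `u(h) = x`. -/
theorem derivGraph_le_mefGraph (F : ℝ≥0 → E →L[𝕜] E) : derivGraph F ≤ mefGraph F :=
  fun w hw => ⟨fun _ => w.1, tendsto_const_nhds, hw⟩

/-- Necessity of the generation conditions, with `F = T` the semigroup itself. -/
theorem IsGeneratorOf.memF_and_generationConditions [T2Space E] {Z : E →ₗ.[𝕜] E}
    (hZ : Dense (Z.domain : Set E)) {t : ℝ≥0} (ht : 0 < t) {T : ℝ≥0 → E →L[𝕜] E}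
    (hT : IsGeneratorOf Z.closure T) : MemF T ∧ GenerationConditions Z t T := by
  obtain ⟨hT, hgen⟩ := hT
  have hgr : Z.closure.graph = derivGraph T := by rw [hgen, strongDeriv_graph]
  have hmem : ∀ x : Z.domain, ((x : E), Z x) ∈ derivGraph T := fun x => by
    rw [← hgr]
    exact LinearPMap.le_graph_of_le Z.le_closure (Z.mem_graph x)
  have hdom : Z.domain ≤ (effDeriv T).domain := fun x hx =>
    (mem_effDeriv_domain T x).2 ⟨_, derivGraph_le_mefGraph T (hmem ⟨x, hx⟩)⟩
  have hF : MemF T := ⟨hT.toMemE, hZ.mono hdom⟩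
  refine ⟨hF, ⟨hdom, ?_⟩, hT.starDense, Z.domain, le_rfl, hZ, fun f hf s => ?_⟩
  · rintro x y hxy
    have h1 := effDeriv_mem T hF.subsingleton_mefDeriv y
    rw [← hxy] at h1
    exact hF.subsingleton_mefDeriv _ (derivGraph_le_mefGraph T (hmem x)) h1
  · let r : ℕ → ℝ≥0 := fun n => (⌊n * s / t⌋₊ : ℕ) * (t / n)
    have hr : Tendsto r atTop (𝓝 s) := by
      have hh : Tendsto (fun k : ℕ => t / (id k : ℕ)) atTop (𝓝[>] 0) :=
        tendsto_div_nat ht strictMono_id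
      rw [tendsto_iff_dist_tendsto_zero]
      refine squeeze_zero' (Eventually.of_forall fun _ => dist_nonneg) ?_
        (tendsto_coe_nhdsGT_zero.comp hh)
      filter_upwards [hh.eventually self_mem_nhdsWithin] with n hn
      have := abs_natFloor_sub_mul_sub_le (r := 0) (d := s) hn
      rw [NNReal.dist_eq]
      simp only [r, natCast_mul_div]
      simpa using this
    have hTr : ∀ n : ℕ, (T (t / n) ^ ⌊n * s / t⌋₊) f = T (r n) f := fun n => by
      rw [pow_eq_of_map_add hT.map_zero hT.map_add]
    have hgraph : ∀ n, ∃ a : Z.closure.domain, (a : E) = T (r n) f ∧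
        Z.closure a = T (r n) (Z ⟨f, hf⟩) := fun n => by
      have := hT.mem_derivGraph_apply (r n) (hmem ⟨f, hf⟩)
      rw [← hgr, LinearPMap.mem_graph_iff] at this
      exact this
    choose a ha1 ha2 using hgraph
    refine ⟨a, fun φ => ?_, ?_, ?_⟩
    · simp only [hTr, ha1, sub_self]
      exact tendsto_const_nhds
    · simp only [ha2]
      exact weakSeqRelCompact_of_tendsto (((hT.continuous _).tendsto s).comp hr)
    · simp only [ha1]
      exact weakSeqRelCompact_of_tendsto (((hT.continuous _).tendsto s).comp hr)

end Necessity

end LocConv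

theorem theorem8p2 {𝕜 E : Type*} [RCLike 𝕜] [AddCommGroup E] [Module 𝕜 E] [UniformSpace E]
    [IsUniformAddGroup E] [ContinuousSMul 𝕜 E] [PolynormableSpace 𝕜 E] [T2Space E]
    [CompleteSpace E] (Z : E →ₗ.[𝕜] E) (hZ : Dense (Z.domain : Set E)) (t : ℝ≥0) (ht : 0 < t) :
    ((Z.IsClosable ∧ ∃ T : ℝ≥0 → E →L[𝕜] E, LocConv.IsGeneratorOf Z.closure T) ↔
      ∃ F : ℝ≥0 → E →L[𝕜] E, LocConv.MemF F ∧ LocConv.GenerationConditions Z t F) ∧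
    ∀ F : ℝ≥0 → E →L[𝕜] E, LocConv.MemF F → LocConv.GenerationConditions Z t F →
      ∀ T : ℝ≥0 → E →L[𝕜] E, LocConv.IsGeneratorOf Z.closure T →
        ∀ f : E, Tendsto (fun n : ℕ => (F (t / n) ^ n) f) atTop (𝓝 (T t f)) := by
  refine ⟨⟨?_, ?_⟩, fun F hF hG T hT f =>
    hF.tendsto_pow_of_isGeneratorOf hZ hG.extends_op hT ht f⟩
  · rintro ⟨-, T, hT⟩
    exact ⟨T, hT.memF_and_generationConditions hZ ht⟩
  · rintro ⟨F, hF, hG⟩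
    exact ⟨hF.isClosable hG.extends_op, hG.exists_isGeneratorOf hF ht⟩
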